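/- A *Fractran program* is a finite list $P = \frac{p_1}{q_1},\dots,\frac{p_k}{q_k}$ of fractions with $p_i,q_i$ positive integers. Let $f_P:\mathbb N\rightharpoonup\mathbb N$ be the partial function with $f_P(n)=n\cdot\frac{p_i}{q_i}$, where $\frac{p_i}{q_i}$ is the first fraction of $P$ with $n\cdot\frac{p_i}{q_i}\in\mathbb N$, and $f_P(n)$ undefined if there is no such fraction. $P$ *halts on* $n$ if $f_P^i(n)$ is undefined for some $i\in\mathbb N$. The *uniform halting problem* for Fractran asks, given $P$, whether $P$ halts on every integer $n>0$. Let $f'_P:\mathbb N\to\mathbb N$ be the total function obtained from $f_P$ by replacing "undefined" by $1$. A *Collatz function* is a function $f:\mathbb N\to\mathbb N$ such that for some integer $p>0$ and rationals $a_0,b_0,\dots,a_{p-1},b_{p-1}$ one has $f(n)=a_i n+b_i$ whenever $n\equiv i \pmod p$, $0\le i<p$. The *generalised Collatz problem* (GCP) asks, given the list $(a_0,b_0),\dots,(a_{p-1},b_{p-1})$ of a Collatz function $f$, whether for every integer $x>0$ there is $i\in\mathbb N$ with $f^i(x)=1$; lists that do not describe a Collatz function count as negative instances. A predicate is $\Pi^0_2$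 if it has the form $\forall x\,\exists y\,R(\cdot,x,y)$ with $R$ decidable; a problem is $\Pi^0_2$-hard if every $\Pi^0_2$ set of natural numbers is many-one reducible to it by a computable function, and $\Pi^0_2$-complete if it is moreover itself $\Pi^0_2$. **Corollary.** 1. For every Fractran program $P$, the function $f'_P$ is a Collatz function, and $P$ halts on every $n>0$ if and only if for every $x>0$ there is $i\in\mathbb N$ with $(f'_P)^i(x)=1$. 2. There is a computable map sending each Fractran program $P$ to a list describing $f'_P$ as a Collatz function, whose modulus $p$ is the least common multiple of the denominators $q_1,\dots,q_k$; so $P$ is a positive instance of the Fractran uniform halting problem if and only if its image is a positive instance of GCP. 3. The uniform halting problem for Fractran programs is $\Pi^0_2$-hard. 4. GCP is $\Pi^0_2$-hard; in fact it is $\Pi^0_2$-complete (the result of Kurtz and Simon). -/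

import Mathlib

/-! ### The class `Π⁰₂`, hardness and completeness under computable many-one reductions -/

/-- `p` is a `Π⁰₂` predicate: `p a ↔ ∀ x, ∃ y, R (a, x, y)` for a decidable relation `R`. -/
def IsPi02 {α : Type*} [Primcodable α] (p : α → Prop) : Prop :=
  ∃ R : α × ℕ × ℕ → Prop, ComputablePred R ∧ ∀ a, p a ↔ ∀ x, ∃ y, R (a, x, y)

/-- `p` is `Π⁰₂`-hard: every `Π⁰₂` set of natural numbers many-one reduces to `p`
through a computable function. -/
def IsPi02Hard {α : Type*} [Primcodable α] (p : α → Prop) : Prop :=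
  ∀ q : ℕ → Prop, IsPi02 q → ManyOneReducible q p

/-- `p` is `Π⁰₂`-complete. -/
def IsPi02Complete {α : Type*} [Primcodable α] (p : α → Prop) : Prop :=
  IsPi02 p ∧ IsPi02Hard p

/-! ### Fractran -/

/-- A Fractran program: a finite list of positive fractions, the pair `(p, q)` standing for the
fraction `p / q`. -/
abbrev FractranProgram : Type := List (ℕ+ × ℕ+)

/-- The partial function `f_P`: multiply `n` by the first fraction `p / q` of `P` for which
`n * p / q` is an integer; `none` (undefined) if there is no such fraction. -/
def fractranStep (P : FractranProgram) (n : ℕ) : Option ℕ :=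
  (P.find? fun r => decide ((r.2 : ℕ) ∣ n * (r.1 : ℕ))).map fun r => n * (r.1 : ℕ) / (r.2 : ℕ)

/-- `P` halts on `n`: some iterate of the partial function `f_P` is undefined at `n`. -/
def FractranHaltsOn (P : FractranProgram) (n : ℕ) : Prop :=
  ∃ i : ℕ, (fun o : Option ℕ => o.bind (fractranStep P))^[i] (some n) = none

/-- The uniform halting problem: `P` halts on every positive integer. -/
def FractranUniformHalting (P : FractranProgram) : Prop :=
  ∀ n : ℕ, 0 < n → FractranHaltsOn P n

/-- The total function `f'_P`, obtained from `f_P` by replacing "undefined" by `1`. -/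
def fractranTotalStep (P : FractranProgram) (n : ℕ) : ℕ :=
  (fractranStep P n).getD 1

/-- The least common multiple of the denominators of `P` (it is `1` for the empty program). -/
def fractranDenLcm (P : FractranProgram) : ℕ :=
  P.foldr (fun r d => Nat.lcm (r.2 : ℕ) d) 1

/-! ### Collatz functions and the generalised Collatz problem -/

/-- `f n = a_i * n + b_i` whenever `n ≡ i (mod p)`, `0 ≤ i < p`, where `p` is positive. Only the
values `a 0, …, a (p - 1)` and `b 0, …, b (p - 1)` matter. -/
def IsCollatzWith (p : ℕ) (a b : ℕ → ℚ) (f : ℕ → ℕ) : Prop :=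
  0 < p ∧ ∀ n : ℕ, (f n : ℚ) = a (n % p) * (n : ℚ) + b (n % p)

/-- `f` is a Collatz function. -/
def IsCollatzFunction (f : ℕ → ℕ) : Prop :=
  ∃ (p : ℕ) (a b : ℕ → ℚ), IsCollatzWith p a b f

/-- Every `x > 0` eventually reaches `1` under iteration of `f`. -/
def AllReachOne (f : ℕ → ℕ) : Prop :=
  ∀ x : ℕ, 0 < x → ∃ i : ℕ, f^[i] x = 1

/-- A code for a rational number: numerator and positive denominator. -/
abbrev RatCode : Type := ℤ × ℕ+

/-- The rational number with a given code. -/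
def RatCode.value (r : RatCode) : ℚ := (r.1 : ℚ) / ((r.2 : ℕ) : ℚ)

/-- A finite description `(a_0, b_0), …, (a_{p-1}, b_{p-1})` of a Collatz function; the modulus
`p` is the length of the list. -/
abbrev CollatzCode : Type := List (RatCode × RatCode)

/-- The coefficient `a_i` (irrelevant value for `i ≥ p`). -/
def collatzSlope (c : CollatzCode) (i : ℕ) : ℚ := RatCode.value (c.getD i ((0, 1), (0, 1))).1

/-- The coefficient `b_i` (irrelevant value for `i ≥ p`). -/
def collatzOffset (c : CollatzCode) (i : ℕ) : ℚ := RatCode.value (c.getD i ((0, 1), (0, 1))).2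

/-- The list `c` describes the Collatz function `f`. There is at most one such `f`, and there is
none when the list is empty or some value `a_i * n + b_i` is not a natural number. -/
def CollatzRepresents (c : CollatzCode) (f : ℕ → ℕ) : Prop :=
  IsCollatzWith c.length (collatzSlope c) (collatzOffset c) f

/-- The generalised Collatz problem: `c` describes a Collatz function for which every `x > 0`
eventually reaches `1`. -/
def GeneralisedCollatz (c : CollatzCode) : Prop :=
  ∃ f : ℕ → ℕ, CollatzRepresents c f ∧ AllReachOne f

/-! ### Fractran programs as Collatz functions -/

/-! Whether `q ∣ n * p` depends only on `n` modulo the lcm `D` of the denominators, so each residue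
class mod `D` uses one fixed fraction or the constant `1`; this gives the list `fractranToCollatz`.
A halting run reaches `1` under `f'_P`. Conversely, if `f_P` is undefined at `1`, reaching `1` means
halting. If `f_P` is defined at `1`, some fraction is an integer, so `f_P` is total and preserves
divisibility by numbers coprime to `D`; the orbit of `D + 1` then avoids `1`
(`fractranUniformHalting_iff_allReachOne`).

For hardness, a `Π⁰₂` set is written as `∀ x, ∃ k, h (a, x, k) ≠ 0` with `h` primitive recursive and
monotone in `k` (`IsPi02.exists_primrec`). A loop program computes `h`
(`LoopProg.computable_of_primrec'`); it is compiled to a counter machine and repeated with growing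
`k` until the output is nonzero. Uniform halting ranges over all positive integers, so junk starting
states must be harmless. Loop code runs to its end from any internal position
(`LoopProg.reaches_end`); each round resets the register holding `a`; the register holding `x` is
arbitrary, which supplies the quantifier `∀ x`; an arbitrary initial `k` does no damage by
monotonicity. States are encoded as integers with one marker prime for the position and register
values as exponents. Integers with several markers are shrunk by leading fractions `1 / (p_i p_j)`,
and those with no marker halt at once (`FractranSim.uniformHalting_program`).

GCP is itself `Π⁰₂` because the legitimacy of the list can be tested pointwise under the same `∀ x`
(`generalisedCollatz_iff`). -/

theorem fractranStep_eq_none_iff {P : FractranProgram} {n : ℕ} :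
    fractranStep P n = none ↔ ∀ r ∈ P, ¬ (r.2 : ℕ) ∣ n * r.1 := by
  simp [fractranStep]

theorem den_dvd_fractranDenLcm {P : FractranProgram} {r : ℕ+ × ℕ+} (hr : r ∈ P) :
    (r.2 : ℕ) ∣ fractranDenLcm P := by
  induction P with
  | nil => simp at hr
  | cons a P ih =>
    rcases List.mem_cons.1 hr with rfl | h
    · exact Nat.dvd_lcm_left _ _
    · exact (ih h).trans (Nat.dvd_lcm_right _ _)

theorem fractranDenLcm_pos (P : FractranProgram) : 0 < fractranDenLcm P := by
  induction P with
  | nil => simp [fractranDenLcm]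
  | cons a P ih => exact Nat.lcm_pos a.2.pos ih

/-- The fraction applied to `n` depends only on `n` modulo the lcm of the denominators. -/
theorem fractran_find_mod (P : FractranProgram) (n : ℕ) :
    (P.find? fun r => decide ((r.2 : ℕ) ∣ n * (r.1 : ℕ))) =
      P.find? fun r => decide ((r.2 : ℕ) ∣ n % fractranDenLcm P * (r.1 : ℕ)) := by
  apply List.find?_congr
  intro r hr
  have h := den_dvd_fractranDenLcm hr
  have : n * (r.1 : ℕ) ≡ n % fractranDenLcm P * r.1 [MOD r.2] :=
    (((Nat.mod_modEq n _).symm).of_dvd h).mul_right _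
  simp only [decide_eq_decide]
  exact this.dvd_iff dvd_rfl

/-- The pair `(a_i, b_i)` for the fraction selected in a residue class. -/
def collatzEntry (o : Option (ℕ+ × ℕ+)) : RatCode × RatCode :=
  o.elim ((0, 1), (1, 1)) fun r => ((((r.1 : ℕ) : ℤ), r.2), (0, 1))

/-- The description of `f'_P` as a Collatz function modulo the lcm of the denominators. -/
def fractranToCollatz (P : FractranProgram) : CollatzCode :=
  (List.range (fractranDenLcm P)).map fun i =>
    collatzEntry (P.find? fun r => decide ((r.2 : ℕ) ∣ i * (r.1 : ℕ)))

theorem length_fractranToCollatz (P : FractranProgram) :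
    (fractranToCollatz P).length = fractranDenLcm P := by
  simp [fractranToCollatz]

theorem fractranToCollatz_represents (P : FractranProgram) :
    CollatzRepresents (fractranToCollatz P) (fractranTotalStep P) := by
  refine ⟨by rw [length_fractranToCollatz]; exact fractranDenLcm_pos P, fun n => ?_⟩
  have hlt : n % fractranDenLcm P < fractranDenLcm P := Nat.mod_lt _ (fractranDenLcm_pos P)
  have hget : (fractranToCollatz P).getD (n % fractranDenLcm P) ((0, 1), (0, 1)) =
      collatzEntry (P.find? fun r => decide ((r.2 : ℕ) ∣ n * (r.1 : ℕ))) := by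
    rw [fractran_find_mod, List.getD_eq_getElem _ _ (by rwa [length_fractranToCollatz])]
    simp [fractranToCollatz]
  rw [length_fractranToCollatz, collatzSlope, collatzOffset, hget, fractranTotalStep,
    fractranStep]
  rcases h : (P.find? fun r => decide ((r.2 : ℕ) ∣ n * (r.1 : ℕ))) with _ | r
  · simp [h, collatzEntry, RatCode.value]
  · have hd : (r.2 : ℕ) ∣ n * r.1 := by simpa using List.find?_some h
    have h0 : ((r.2 : ℕ) : ℚ) ≠ 0 := by exact_mod_cast r.2.pos.ne'
    simp only [h, collatzEntry, RatCode.value, Option.map_some, Option.getD_some, Option.elim_some]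
    rw [Nat.cast_div hd h0]
    push_cast
    simp
    ring

theorem isCollatzFunction_fractranTotalStep (P : FractranProgram) :
    IsCollatzFunction (fractranTotalStep P) :=
  ⟨_, _, _, fractranToCollatz_represents P⟩

theorem IsCollatzWith.unique {p : ℕ} {a b : ℕ → ℚ} {f g : ℕ → ℕ} (hf : IsCollatzWith p a b f)
    (hg : IsCollatzWith p a b g) : f = g := by
  funext n
  exact_mod_cast (hf.2 n).trans (hg.2 n).symm

/-! ### Halting of partial iterations -/

/-- Some iterate of the partial function `f` is undefined at `a`. -/
def HaltsFrom {σ : Type*} (f : σ → Option σ) (a : σ) : Prop :=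
  ∃ i : ℕ, (fun o : Option σ => o.bind f)^[i] (some a) = none

section HaltsFrom

variable {σ : Type*} {f : σ → Option σ} {a b : σ}

theorem haltsFrom_of_eq_none (h : f a = none) : HaltsFrom f a := ⟨1, by simpa using h⟩

theorem haltsFrom_iff_of_eq_some (h : f a = some b) : HaltsFrom f a ↔ HaltsFrom f b := by
  constructor
  · rintro ⟨_ | i, hi⟩
    · simp at hi
    · exact ⟨i, by simpa [Function.iterate_succ_apply, h] using hi⟩
  · rintro ⟨i, hi⟩
    exact ⟨i + 1, by simpa [Function.iterate_succ_apply, h] using hi⟩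

theorem haltsFrom_iff_of_reaches (h : StateTransition.Reaches f a b) :
    HaltsFrom f a ↔ HaltsFrom f b := by
  induction h with
  | refl => rfl
  | tail _ h ih => rw [ih, haltsFrom_iff_of_eq_some h]

/-- Bridge to the simulation theory of `StateTransition`, whose `Respects` relations transfer
termination in both directions. -/
theorem haltsFrom_iff_eval_dom : HaltsFrom f a ↔ (StateTransition.eval f a).Dom := by
  constructor
  · rintro ⟨i, hi⟩
    induction i generalizing a with
    | zero => simp at hi
    | succ i ih =>
      rcases h : f a with _ | b
      · exact Part.dom_iff_mem.2 ⟨a, StateTransition.mem_eval.2 ⟨.refl, h⟩⟩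
      · rw [StateTransition.reaches_eval (Relation.ReflTransGen.single h)]
        exact ih (by simpa [Function.iterate_succ_apply, h] using hi)
  · intro h
    obtain ⟨b, hb⟩ := Part.dom_iff_mem.1 h
    obtain ⟨h1, h2⟩ := StateTransition.mem_eval.1 hb
    exact (haltsFrom_iff_of_reaches h1).2 (haltsFrom_of_eq_none h2)

/-- A set from which every state returns to the set after at least one step has no halting state. -/
theorem not_haltsFrom_of_invariant (S : σ → Prop)
    (hS : ∀ a, S a → ∃ b, S b ∧ StateTransition.Reaches₁ f a b) (ha : S a) : ¬ HaltsFrom f a := by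
  -- `f` simulates the one-state machine that steps forever, hence inherits its divergence.
  have hr : StateTransition.Respects (fun u : Unit => some u) f (fun _ a => S a) := by
    intro _ a h
    obtain ⟨b, hb, hab⟩ := hS a h
    exact ⟨b, hb, hab⟩
  rw [haltsFrom_iff_eval_dom, StateTransition.tr_eval_dom hr (a₁ := ()) ha]
  intro h
  obtain ⟨b, hb⟩ := Part.dom_iff_mem.1 h
  simpa using (StateTransition.mem_eval.1 hb).2

end HaltsFrom

theorem fractranHaltsOn_iff {P : FractranProgram} {n : ℕ} :
    FractranHaltsOn P n ↔ HaltsFrom (fractranStep P) n := Iff.rfl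

theorem fractranTotalStep_of_some {P : FractranProgram} {n m : ℕ} (h : fractranStep P n = some m) :
    fractranTotalStep P n = m := by simp [fractranTotalStep, h]

theorem fractranStep_pos {P : FractranProgram} {n m : ℕ} (hn : 0 < n)
    (h : fractranStep P n = some m) : 0 < m := by
  obtain ⟨r, hr, rfl⟩ : ∃ r, (P.find? fun r => decide ((r.2 : ℕ) ∣ n * (r.1 : ℕ))) = some r ∧
      n * (r.1 : ℕ) / (r.2 : ℕ) = m := by simpa only [fractranStep, Option.map_eq_some_iff] using h
  have hd : (r.2 : ℕ) ∣ n * r.1 := by simpa using List.find?_some hr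
  exact Nat.div_pos (Nat.le_of_dvd (Nat.mul_pos hn r.1.pos) hd) r.2.pos

theorem reach_one_of_fractranHaltsOn {P : FractranProgram} {n : ℕ} (h : FractranHaltsOn P n) :
    ∃ i, (fractranTotalStep P)^[i] n = 1 := by
  obtain ⟨i, hi⟩ := h
  induction i generalizing n with
  | zero => simp at hi
  | succ i ih =>
    rcases h : fractranStep P n with _ | m
    · exact ⟨1, by simp [fractranTotalStep, h]⟩
    · obtain ⟨j, hj⟩ := ih (n := m) (by simpa [Function.iterate_succ_apply, h] using hi)
      exact ⟨j + 1, by rwa [Function.iterate_succ_apply, fractranTotalStep_of_some h]⟩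

/-- A value `1` of `f'_P` is either the default or a genuine value of `f_P`; halting at `1` covers
the second case. -/
theorem fractranHaltsOn_of_reach_one {P : FractranProgram} (h1 : FractranHaltsOn P 1) {n i : ℕ}
    (h : (fractranTotalStep P)^[i] n = 1) : FractranHaltsOn P n := by
  induction i generalizing n with
  | zero => simpa [← show n = 1 from h] using h1
  | succ i ih =>
    rcases hs : fractranStep P n with _ | m
    · exact haltsFrom_of_eq_none hs
    · rw [Function.iterate_succ_apply, fractranTotalStep_of_some hs] at h
      exact (haltsFrom_iff_of_eq_some hs).2 (ih h)

/-- If `f_P` is defined at `1`, it preserves divisibility by numbers coprime to the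
denominators. -/
theorem dvd_fractranTotalStep {P : FractranProgram} (h1 : fractranStep P 1 ≠ none) {Q n : ℕ}
    (hQ : Nat.Coprime Q (fractranDenLcm P)) (hn : Q ∣ n) : Q ∣ fractranTotalStep P n := by
  rcases h : (P.find? fun r => decide ((r.2 : ℕ) ∣ n * (r.1 : ℕ))) with _ | r
  -- A fraction applicable at `1` is an integer, so it applies at every `n` and the undefined case
  -- cannot occur.
  · refine absurd (fractranStep_eq_none_iff.2 fun r hr hd => ?_) h1
    have := List.find?_eq_none.1 h r hr
    simp only [one_mul, decide_eq_true_eq] at hd this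
    exact this (hd.mul_left n)
  · have hd : (r.2 : ℕ) ∣ n * r.1 := by simpa using List.find?_some h
    have hr : Nat.Coprime Q r.2 :=
      hQ.coprime_dvd_right (den_dvd_fractranDenLcm (List.mem_of_find?_eq_some h))
    simp only [fractranTotalStep, fractranStep, h, Option.map_some, Option.getD_some]
    refine hr.dvd_of_dvd_mul_right ?_
    rw [Nat.div_mul_cancel hd]
    exact hn.mul_right _

theorem fractranUniformHalting_iff_allReachOne (P : FractranProgram) :
    FractranUniformHalting P ↔ AllReachOne (fractranTotalStep P) := by
  refine ⟨fun h n hn => reach_one_of_fractranHaltsOn (h n hn), fun h => ?_⟩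
  have h1 : fractranStep P 1 = none := by
    by_contra h1
    -- `D + 1` is coprime to every denominator and exceeds `1`, so its orbit consists of multiples
    -- of `D + 1` and misses `1`.
    have hQ : Nat.Coprime (fractranDenLcm P + 1) (fractranDenLcm P) := by simp
    obtain ⟨i, hi⟩ := h (fractranDenLcm P + 1) (Nat.succ_pos _)
    have : ∀ i, fractranDenLcm P + 1 ∣ (fractranTotalStep P)^[i] (fractranDenLcm P + 1) := by
      intro i
      induction i with
      | zero => exact dvd_rfl
      | succ i ih =>
        rw [Function.iterate_succ_apply']
        exact dvd_fractranTotalStep h1 hQ ih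
    have h2 := this i
    rw [hi, Nat.dvd_one] at h2
    have := fractranDenLcm_pos P
    omega
  intro n hn
  obtain ⟨i, hi⟩ := h n hn
  exact fractranHaltsOn_of_reach_one (haltsFrom_of_eq_none h1) hi

theorem fractranUniformHalting_iff_generalisedCollatz (P : FractranProgram) :
    FractranUniformHalting P ↔ GeneralisedCollatz (fractranToCollatz P) := by
  rw [fractranUniformHalting_iff_allReachOne]
  constructor
  · exact fun h => ⟨_, fractranToCollatz_represents P, h⟩
  · rintro ⟨f, hf, h⟩
    rwa [← IsCollatzWith.unique hf (fractranToCollatz_represents P)]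

/-! ### Computability of the translation -/

theorem Primrec.pnat_val : Primrec fun n : ℕ+ => (n : ℕ) :=
  (Primrec.succ.comp Primrec.encode).of_eq fun n => PNat.succPNat_natPred n ▸ rfl

theorem Primrec.nat_succPNat : Primrec Nat.succPNat :=
  Primrec.encode_iff.1 (Primrec.id.of_eq fun _ => rfl)

theorem Primrec.int_natCast : Primrec fun n : ℕ => (n : ℤ) :=
  Primrec.encode_iff.1 (Primrec.nat_double.of_eq fun _ => rfl)

/-- The encoding sends `n` to `2 * n` and `-(n + 1)` to `2 * n + 1`, so parity gives the sign and
halving gives the magnitude. -/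
theorem Primrec.int_toNat : Primrec Int.toNat := by
  refine ((Primrec.cond (Primrec.nat_bodd.comp Primrec.encode) (Primrec.const 0)
    (Primrec.nat_div2.comp Primrec.encode)).of_eq fun z => ?_)
  rcases z with n | n
  · have : Encodable.encode (n : ℤ) = 2 * n := rfl
    simp [this]
  · have : Encodable.encode (Int.negSucc n) = 2 * n + 1 := rfl
    simp [this]

theorem Primrec.int_neg_toNat : Primrec fun z : ℤ => (-z).toNat := by
  refine ((Primrec.cond (Primrec.nat_bodd.comp Primrec.encode)
    (Primrec.succ.comp (Primrec.nat_div2.comp Primrec.encode)) (Primrec.const 0)).of_eq fun z => ?_)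
  rcases z with n | n
  · have : Encodable.encode (n : ℤ) = 2 * n := rfl
    simp [this]
  · have : Encodable.encode (Int.negSucc n) = 2 * n + 1 := rfl
    simp [this]

/-- The gcd is found by bounded search; the bound `a + b` works even if one argument is zero, and
gives `0` when both are. -/
theorem Primrec.nat_gcd : Primrec₂ Nat.gcd := by
  have : Primrec fun p : ℕ × ℕ =>
      Nat.findGreatest (fun d => p.1 % d = 0 ∧ p.2 % d = 0) (p.1 + p.2) := by
    refine Primrec.nat_findGreatest (Primrec.nat_add.comp .fst .snd) ?_
    exact PrimrecPred.and
      (Primrec.eq.comp (Primrec.nat_mod.comp (Primrec.fst.comp .fst) .snd) (Primrec.const 0))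
      (Primrec.eq.comp (Primrec.nat_mod.comp (Primrec.snd.comp .fst) .snd) (Primrec.const 0))
  refine Primrec.of_eq this fun p => ?_
  obtain ⟨a, b⟩ := p
  rw [Nat.findGreatest_eq_iff]
  simp only [← Nat.dvd_iff_mod_eq_zero]
  refine ⟨?_, fun _ => ⟨Nat.gcd_dvd_left _ _, Nat.gcd_dvd_right _ _⟩, ?_⟩
  · rcases Nat.eq_zero_or_pos a with rfl | h
    · simp
    · exact (Nat.gcd_le_left b h).trans (Nat.le_add_right _ _)
  · intro n hn hle ⟨h1, h2⟩
    have hg : 0 < a.gcd b := by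
      rw [Nat.gcd_pos_iff]
      omega
    exact absurd (Nat.le_of_dvd hg (Nat.dvd_gcd h1 h2)) (by omega)

theorem Primrec.nat_lcm : Primrec₂ Nat.lcm :=
  Primrec.nat_div.comp Primrec.nat_mul Primrec.nat_gcd

theorem primrec_fractranDenLcm : Primrec fractranDenLcm :=
  Primrec.list_foldr (h := fun _ (p : (ℕ+ × ℕ+) × ℕ) => Nat.lcm (p.1.2 : ℕ) p.2) Primrec.id (Primrec.const 1)
    (Primrec.nat_lcm.comp
      (Primrec.pnat_val.comp (Primrec.snd.comp (Primrec.fst.comp Primrec.snd)))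
      (Primrec.snd.comp Primrec.snd)).to₂

/-- Puts the search into the fold form to which `Primrec.list_foldr` applies. -/
theorem List.find?_eq_foldr {α : Type*} (p : α → Bool) (l : List α) :
    l.find? p = l.foldr (fun a s => bif p a then some a else s) none := by
  induction l with
  | nil => rfl
  | cons a l ih => rcases h : p a <;> simp [h, ih]

theorem primrec_fractranToCollatz : Primrec fractranToCollatz := by
  have hfind : Primrec fun p : FractranProgram × ℕ =>
      p.1.find? fun r => decide ((r.2 : ℕ) ∣ p.2 * (r.1 : ℕ)) := by
    refine (Primrec.list_foldr
      (h := fun (p : FractranProgram × ℕ) (q : (ℕ+ × ℕ+) × Option (ℕ+ × ℕ+)) =>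
        bif decide (p.2 * (q.1.1 : ℕ) % (q.1.2 : ℕ) = 0) then some q.1 else q.2)
      Primrec.fst (Primrec.const none) ?_).of_eq fun p => ?_
    · have hq : Primrec fun a : (FractranProgram × ℕ) × (ℕ+ × ℕ+) × Option (ℕ+ × ℕ+) => a.2.1 :=
        Primrec.fst.comp .snd
      refine Primrec.cond ?_ (Primrec.option_some.comp hq) (Primrec.snd.comp .snd)
      exact (Primrec.eq.comp (Primrec.nat_mod.comp
        (Primrec.nat_mul.comp (Primrec.snd.comp .fst) (Primrec.pnat_val.comp (Primrec.fst.comp hq)))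
        (Primrec.pnat_val.comp (Primrec.snd.comp hq))) (Primrec.const 0)).decide
    · simp only [List.find?_eq_foldr, Nat.dvd_iff_mod_eq_zero]
  have hentry : Primrec collatzEntry := by
    refine (Primrec.option_casesOn Primrec.id (Primrec.const ((0, 1), (1, 1)))
      (g := fun _ r => (((((r.1 : ℕ+) : ℕ) : ℤ), r.2), (0, 1))) ?_).of_eq fun o => ?_
    · exact (Primrec.pair (Primrec.pair
        (Primrec.int_natCast.comp (Primrec.pnat_val.comp (Primrec.fst.comp .snd)))
        (Primrec.snd.comp .snd)) (Primrec.const _)).to₂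
    · cases o <;> rfl
  exact Primrec.list_map (Primrec.list_range.comp primrec_fractranDenLcm) (hentry.comp hfind).to₂

/-! ### The generalised Collatz problem is `Π⁰₂` -/

/-- The value `a_i * n + b_i` described by an entry `(a_i, b_i)`, if it is a natural number. -/
def collatzEntryValue (e : RatCode × RatCode) (n : ℕ) : Option ℕ :=
  -- Over the common denominator `d`, the numerator is `s - t` with `s` collecting the positive
  -- parts and `t` the negative ones, so only natural-number arithmetic is needed.
  let s := e.1.1.toNat * e.2.2 * n + e.2.1.toNat * e.1.2
  let t := (-e.1.1).toNat * e.2.2 * n + (-e.2.1).toNat * e.1.2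
  let d := (e.1.2 : ℕ) * e.2.2
  if t ≤ s ∧ (s - t) % d = 0 then some ((s - t) / d) else none

theorem collatzEntryValue_eq_some_iff (e : RatCode × RatCode) (n m : ℕ) :
    collatzEntryValue e n = some m ↔ (m : ℚ) = e.1.value * n + e.2.value := by
  obtain ⟨⟨x, p⟩, ⟨y, q⟩⟩ := e
  have hp : ((p : ℕ) : ℚ) ≠ 0 := by exact_mod_cast p.pos.ne'
  have hq : ((q : ℕ) : ℚ) ≠ 0 := by exact_mod_cast q.pos.ne'
  have hd : 0 < (p : ℕ) * q := Nat.mul_pos p.pos q.pos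
  have hx := Int.toNat_sub_toNat_neg x
  have hy := Int.toNat_sub_toNat_neg y
  have key : (m : ℚ) = RatCode.value (x, p) * n + RatCode.value (y, q) ↔
      m * (p * q) + ((-x).toNat * q * n + (-y).toNat * p) = x.toNat * q * n + y.toNat * p := by
    rw [RatCode.value, RatCode.value]
    dsimp only
    rw [div_mul_eq_mul_div, div_add_div _ _ hp hq, eq_div_iff (mul_ne_zero hp hq)]
    rw [← @Nat.cast_inj ℤ]
    have : (m : ℚ) * (p * q) = x * n * q + p * y ↔ (m : ℤ) * (p * q) = x * n * q + p * y := by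
      exact_mod_cast Iff.rfl
    rw [this]
    push_cast only [Nat.cast_add, Nat.cast_mul]
    constructor <;> intro h
    · linear_combination h + (-(q : ℤ) * n) * hx - (p : ℤ) * hy
    · linear_combination h - (-(q : ℤ) * n) * hx + (p : ℤ) * hy
  rw [key]
  simp only [collatzEntryValue]
  generalize (-x).toNat * q * n + (-y).toNat * p = t
  generalize x.toNat * q * n + y.toNat * p = s
  generalize (p : ℕ) * q = d at hd
  rw [Option.ite_none_right_eq_some, Option.some_inj]
  constructor
  · rintro ⟨⟨h1, h2⟩, rfl⟩
    rw [Nat.div_mul_cancel (Nat.dvd_of_mod_eq_zero h2)]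
    omega
  · rintro rfl
    simp [hd]

/-- The partial function described by a list of entries. -/
def collatzStep (c : CollatzCode) (n : ℕ) : Option ℕ :=
  collatzEntryValue (c.getD (n % c.length) ((0, 1), (0, 1))) n

theorem collatzRepresents_iff {c : CollatzCode} {f : ℕ → ℕ} :
    CollatzRepresents c f ↔ c ≠ [] ∧ ∀ n, collatzStep c n = some (f n) := by
  simp only [CollatzRepresents, IsCollatzWith, List.length_pos_iff, collatzStep,
    collatzEntryValue_eq_some_iff, collatzSlope, collatzOffset]

/-- Validity of the code is a condition at each `x`, so it fits under the universal quantifier. The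
case `x = 0` is kept separate: the value there must be a natural number, but no orbit condition is
imposed. -/
theorem generalisedCollatz_iff (c : CollatzCode) :
    GeneralisedCollatz c ↔ ∀ x, ∃ y, c ≠ [] ∧ (collatzStep c x).isSome = true ∧
      (x = 0 ∨ (fun o : Option ℕ => o.bind (collatzStep c))^[y] (some x) = some 1) := by
  have hiter : ∀ f : ℕ → ℕ, (∀ n, collatzStep c n = some (f n)) → ∀ y x,
      (fun o : Option ℕ => o.bind (collatzStep c))^[y] (some x) = some (f^[y] x) := by
    intro f hf y
    induction y with
    | zero => simp
    | succ y ih => intro x; rw [Function.iterate_succ_apply, Option.bind_some, hf, ih]; rfl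
  constructor
  · rintro ⟨f, hf, h⟩ x
    obtain ⟨hc, hf⟩ := collatzRepresents_iff.1 hf
    rcases Nat.eq_zero_or_pos x with rfl | hx
    · exact ⟨0, hc, by simp [hf], Or.inl rfl⟩
    · obtain ⟨i, hi⟩ := h x hx
      exact ⟨i, hc, by simp [hf], Or.inr (by rw [hiter f hf, hi])⟩
  · intro h
    have hc : c ≠ [] := (h 0).choose_spec.1
    have hs : ∀ n, ∃ m, collatzStep c n = some m := fun n => by
      obtain ⟨_, _, h2, _⟩ := h n
      exact Option.isSome_iff_exists.1 h2
    choose f hf using hs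
    refine ⟨f, collatzRepresents_iff.2 ⟨hc, hf⟩, fun x hx => ?_⟩
    obtain ⟨y, _, _, h3⟩ := h x
    rcases h3 with rfl | h3
    · simp at hx
    · rw [hiter f hf] at h3
      exact ⟨y, Option.some_inj.1 h3⟩

theorem primrec_collatzEntryValue : Primrec₂ collatzEntryValue := by
  have num : ∀ {g : ℤ → ℕ}, Primrec g → Primrec fun a : (RatCode × RatCode) × ℕ =>
      g a.1.1.1 * (a.1.2.2 : ℕ) * a.2 + g a.1.2.1 * (a.1.1.2 : ℕ) := fun hg =>
    Primrec.nat_add.comp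
      (Primrec.nat_mul.comp (Primrec.nat_mul.comp
        (hg.comp (Primrec.fst.comp (Primrec.fst.comp .fst)))
        (Primrec.pnat_val.comp (Primrec.snd.comp (Primrec.snd.comp .fst)))) .snd)
      (Primrec.nat_mul.comp (hg.comp (Primrec.fst.comp (Primrec.snd.comp .fst)))
        (Primrec.pnat_val.comp (Primrec.snd.comp (Primrec.fst.comp .fst))))
  have hs := num Primrec.int_toNat
  have ht := num Primrec.int_neg_toNat
  have hd : Primrec fun a : (RatCode × RatCode) × ℕ => (a.1.1.2 : ℕ) * (a.1.2.2 : ℕ) :=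
    Primrec.nat_mul.comp (Primrec.pnat_val.comp (Primrec.snd.comp (Primrec.fst.comp .fst)))
      (Primrec.pnat_val.comp (Primrec.snd.comp (Primrec.snd.comp .fst)))
  have hst := Primrec.nat_sub.comp hs ht
  exact Primrec.ite (PrimrecPred.and (Primrec.nat_le.comp ht hs)
    (Primrec.eq.comp (Primrec.nat_mod.comp hst hd) (Primrec.const 0)))
    (Primrec.option_some.comp (Primrec.nat_div.comp hst hd)) (Primrec.const none)

theorem primrec_collatzStep : Primrec₂ collatzStep :=
  primrec_collatzEntryValue.comp₂
    ((Primrec.list_getD ((0, 1), (0, 1))).comp₂ Primrec₂.left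
      (Primrec.nat_mod.comp₂ Primrec₂.right (Primrec.list_length.comp₂ Primrec₂.left)))
    Primrec₂.right

theorem isPi02_generalisedCollatz : IsPi02 GeneralisedCollatz := by
  refine ⟨fun a => a.1 ≠ [] ∧ (collatzStep a.1 a.2.1).isSome = true ∧
    (a.2.1 = 0 ∨ (fun o : Option ℕ => o.bind (collatzStep a.1))^[a.2.2] (some a.2.1) = some 1),
    ?_, generalisedCollatz_iff⟩
  have hx : Primrec fun a : CollatzCode × ℕ × ℕ => a.2.1 := Primrec.fst.comp .snd
  have h : PrimrecPred fun a : CollatzCode × ℕ × ℕ => a.1 ≠ [] ∧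
      (collatzStep a.1 a.2.1).isSome = true ∧
      (a.2.1 = 0 ∨ (fun o : Option ℕ => o.bind (collatzStep a.1))^[a.2.2] (some a.2.1) = some 1) := by
    refine PrimrecPred.and (PrimrecPred.not (Primrec.eq.comp .fst (Primrec.const [])))
      (PrimrecPred.and (Primrec.eq.comp
        (Primrec.option_isSome.comp (primrec_collatzStep.comp .fst hx)) (Primrec.const true))
      (PrimrecPred.or (Primrec.eq.comp hx (Primrec.const 0)) (Primrec.eq.comp ?_
        (Primrec.const (some 1)))))
    exact Primrec.nat_iterate (Primrec.snd.comp .snd) (Primrec.option_some.comp hx)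
      (Primrec.option_bind .snd (primrec_collatzStep.comp
        (Primrec.fst.comp (Primrec.fst.comp .fst)) .snd).to₂).to₂
  obtain ⟨_, h⟩ := h
  exact ⟨_, h.to_comp⟩

/-! ### Loop programs -/

/-- Loop programs over registers indexed by natural numbers. -/
inductive LoopProg : Type
  | skip : LoopProg
  | add (r k : ℕ) : LoopProg
  | seq (c d : LoopProg) : LoopProg
  | loop (r : ℕ) (c : LoopProg) : LoopProg

namespace LoopProg

open Function

/-- Run `f` while register `r` counts down from `m`. -/
def countdown (f : (ℕ → ℕ) → ℕ → ℕ) (r : ℕ) : ℕ → (ℕ → ℕ) → ℕ → ℕ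
  | 0, v => v
  | m + 1, v => countdown f r m (f (update v r m))

/-- The effect of a program on the registers. The counter of a loop is decremented before each
execution of the body. -/
def run : LoopProg → (ℕ → ℕ) → ℕ → ℕ
  | skip, v => v
  | add r k, v => update v r (v r + k)
  | seq c d, v => run d (run c v)
  | loop r c, v => countdown (run c) r (v r) v

/-- The registers which a program may change. -/
def writes : LoopProg → Set ℕ
  | skip => ∅
  | add r _ => {r}
  | seq c d => writes c ∪ writes d
  | loop r c => insert r (writes c)

/-- No loop body changes the counter of its loop. -/
def WF : LoopProg → Prop
  | skip => True
  | add _ _ => True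
  | seq c d => WF c ∧ WF d
  | loop r c => r ∉ writes c ∧ WF c

theorem countdown_eq_of_ne {f : (ℕ → ℕ) → ℕ → ℕ} {r s : ℕ} (hf : ∀ v, f v s = v s) (hrs : s ≠ r) :
    ∀ m v, countdown f r m v s = v s
  | 0, _ => rfl
  | m + 1, v => by rw [countdown, countdown_eq_of_ne hf hrs m, hf, update_of_ne hrs]

theorem run_eq_of_notMem : ∀ {c : LoopProg} {s : ℕ}, s ∉ writes c → ∀ v, run c v s = v s
  | skip, _, _, _ => rfl
  | add r k, s, h, v => update_of_ne h _ _
  | seq c d, s, h, v => by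
    simp only [writes, Set.mem_union, not_or] at h
    rw [run, run_eq_of_notMem h.2, run_eq_of_notMem h.1]
  | loop r c, s, h, v => by
    simp only [writes, Set.mem_insert_iff, not_or] at h
    exact countdown_eq_of_ne (run_eq_of_notMem h.2) h.1 _ _

theorem run_loop_zero {r : ℕ} {c : LoopProg} {v : ℕ → ℕ} (h : v r = 0) : run (loop r c) v = v := by
  rw [run, h, countdown]

/-- Since the body leaves the counter alone, the remaining `m` rounds are again a run of the loop;
this is the unfolding used in inductions on the counter. -/
theorem run_loop_succ {r m : ℕ} {c : LoopProg} {v : ℕ → ℕ} (hc : r ∉ writes c) (h : v r = m + 1) :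
    run (loop r c) v = run (loop r c) (run c (update v r m)) := by
  rw [run, h, countdown, run, run_eq_of_notMem hc, update_self]

/-- Set a register to zero. -/
def clear (r : ℕ) : LoopProg := loop r skip

theorem wf_clear (r : ℕ) : WF (clear r) := ⟨by simp [writes], trivial⟩

theorem run_clear (r : ℕ) (v : ℕ → ℕ) : run (clear r) v = update v r 0 := by
  induction h : v r generalizing v with
  | zero => rw [clear, run_loop_zero h, ← h, update_eq_self]
  | succ m ih =>
    rw [clear, run_loop_succ (by simp [writes]) h, run]
    exact (ih _ (update_self ..)).trans (update_idem ..)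

/-- Add the value of `r` to both `o` and `t`, clearing `r`. -/
def addBoth (r o t : ℕ) : LoopProg := loop r (seq (add o 1) (add t 1))

theorem run_addBoth {r o t : ℕ} (hro : r ≠ o) (hrt : r ≠ t) (hot : o ≠ t) (v : ℕ → ℕ) :
    run (addBoth r o t) v = update (update (update v o (v o + v r)) t (v t + v r)) r 0 := by
  induction h : v r generalizing v with
  | zero =>
    rw [addBoth, run_loop_zero h]
    funext s
    simp only [update_apply]
    split_ifs <;> simp_all
  | succ m ih =>
    rw [addBoth, run_loop_succ (by simp [writes, hro, hrt]) h]
    rw [addBoth] at ih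
    rw [ih _ (by simp [run, hro, hrt])]
    funext s
    simp only [run, update_apply]
    split_ifs <;> simp_all <;> omega

/-- Copy `r` to `o` using the auxiliary register `t`. -/
def copy (r o t : ℕ) : LoopProg :=
  seq (clear o) (seq (clear t) (seq (addBoth r o t) (loop t (add r 1))))

theorem writes_copy (r o t : ℕ) : writes (copy r o t) ⊆ {r, o, t} := by
  intro s
  simp only [copy, clear, addBoth, writes, Set.mem_union, Set.mem_insert_iff,
    Set.mem_singleton_iff, Set.mem_empty_iff_false]
  tauto

theorem wf_copy {r o t : ℕ} (hro : r ≠ o) (hrt : r ≠ t) : WF (copy r o t) := by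
  simp [copy, clear, addBoth, WF, writes, hro, hrt, hrt.symm]

theorem run_restore {r t : ℕ} (hrt : r ≠ t) (v : ℕ → ℕ) :
    run (loop t (add r 1)) v = update (update v r (v r + v t)) t 0 := by
  induction h : v t generalizing v with
  | zero =>
    rw [run_loop_zero h]
    funext s
    simp only [update_apply]
    split_ifs <;> simp_all
  | succ m ih =>
    rw [run_loop_succ (by simp [writes, hrt.symm]) h, ih _ (by simp [run, hrt.symm])]
    funext s
    simp only [run, update_apply]
    split_ifs <;> simp_all
    omega

theorem run_copy {r o t : ℕ} (hro : r ≠ o) (hrt : r ≠ t) (hot : o ≠ t) (v : ℕ → ℕ) :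
    run (copy r o t) v = update (update v o (v r)) t 0 := by
  simp only [copy, run_clear, run_addBoth hro hrt hot, run_restore hrt, run.eq_3]
  funext s
  simp only [update_apply]
  split_ifs <;> simp_all

/-- `c` stores `f` of the contents of the registers `ins` in `o`, and otherwise only changes
registers from `b` on, except that it may temporarily change registers in `ins`. -/
structure Computes {n : ℕ} (c : LoopProg) (f : List.Vector ℕ n → ℕ) (ins : Fin n → ℕ) (o b : ℕ) :
    Prop where
  wf : c.WF
  writes_sub : ∀ r ∈ c.writes, (∃ i, ins i = r) ∨ r = o ∨ b ≤ r
  preserves : ∀ v r, r < b → r ≠ o → c.run v r = v r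
  value : ∀ v, c.run v o = f (List.Vector.ofFn fun i => v (ins i))

/-- `f` can be computed with every choice of input, output and working registers. -/
def Computable {n : ℕ} (f : List.Vector ℕ n → ℕ) : Prop :=
  ∀ (ins : Fin n → ℕ) (o b : ℕ), (∀ i, ins i < b) → o < b → (∀ i, ins i ≠ o) →
    ∃ c, Computes c f ins o b

theorem computable_zero : Computable (n := 0) fun _ => 0 := fun ins o b _ _ _ =>
  ⟨clear o, wf_clear o, by simp [clear, writes], fun v r _ hr => by
    rw [run_clear, update_of_ne hr], fun v => by rw [run_clear, update_self]⟩

theorem computable_get {n : ℕ} (i : Fin n) : Computable fun v : List.Vector ℕ n => v.get i := by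
  intro ins o b hi ho hio
  have h1 := (hi i).ne
  refine ⟨copy (ins i) o b, wf_copy (hio i) h1, fun r hr => ?_, fun v r hr hro => ?_, fun v => ?_⟩
  · rcases writes_copy _ _ _ hr with rfl | rfl | rfl
    · exact Or.inl ⟨i, rfl⟩
    · exact Or.inr (Or.inl rfl)
    · exact Or.inr (Or.inr le_rfl)
  · rw [run_copy (hio i) h1 ho.ne, update_of_ne hr.ne, update_of_ne hro]
  · rw [run_copy (hio i) h1 ho.ne, update_of_ne ho.ne, update_self]
    simp

theorem computable_succ : Computable (n := 1) fun v => v.head.succ := by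
  intro ins o b hi ho hio
  obtain ⟨c, hc⟩ := computable_get (0 : Fin 1) ins o b hi ho hio
  refine ⟨seq c (add o 1), ⟨hc.wf, trivial⟩, fun r hr => ?_, fun v r hr hro => ?_, fun v => ?_⟩
  · rcases hr with hr | hr
    · exact hc.writes_sub r hr
    · exact Or.inr (Or.inl hr)
  · rw [run, run, update_of_ne hro, hc.preserves v r hr hro]
  · rw [run, run, update_self, hc.value]
    simp

theorem computable_comp {m n : ℕ} {f : List.Vector ℕ n → ℕ} {g : Fin n → List.Vector ℕ m → ℕ}
    (hf : Computable f) (hg : ∀ i, Computable (g i)) :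
    Computable fun a => f (List.Vector.ofFn fun i => g i a) := by
  intro ins o b hi ho hio
  -- The value of `g i` is stored in register `b + i`, and scratch space starts at `b + n`, so later
  -- computations preserve earlier results.
  have args : ∀ j ≤ n, ∃ c : LoopProg, c.WF ∧
      (∀ r ∈ c.writes, (∃ i, ins i = r) ∨ b ≤ r) ∧ (∀ v r, r < b → c.run v r = v r) ∧
      ∀ v (i : Fin n), (i : ℕ) < j → c.run v (b + i) = g i (List.Vector.ofFn fun k => v (ins k)) := by
    intro j
    induction j with
    | zero => exact fun _ => ⟨skip, trivial, by simp [writes], fun _ _ _ => rfl, by simp⟩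
    | succ j ih =>
      intro hj
      obtain ⟨c, h1, h2, h3, h4⟩ := ih (by omega)
      obtain ⟨d, hd⟩ := hg ⟨j, hj⟩ ins (b + j) (b + n) (fun i => (hi i).trans_le (by omega))
        (by omega) (fun i => ((hi i).trans_le (by omega)).ne)
      refine ⟨seq c d, ⟨h1, hd.wf⟩, ?_, fun v r hr => ?_, fun v i hij => ?_⟩
      · rintro r (hr | hr)
        · exact h2 r hr
        · rcases hd.writes_sub r hr with h | h | h
          · exact Or.inl h
          · right; omega
          · right; omega
      · rw [run, hd.preserves _ _ (by omega) (by omega), h3 v r hr]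
      · rw [run]
        rcases Nat.lt_succ_iff_lt_or_eq.1 hij with h | h
        · rw [hd.preserves _ _ (by omega) (by omega), h4 v i h]
        · obtain rfl : i = ⟨j, hj⟩ := Fin.ext h
          rw [hd.value]
          simp only [h3 v _ (hi _)]
  obtain ⟨c, h1, h2, h3, h4⟩ := args n le_rfl
  obtain ⟨d, hd⟩ := hf (fun i => b + i) o (b + n) (fun i => by omega) (by omega) (fun i => by omega)
  refine ⟨seq c d, ⟨h1, hd.wf⟩, ?_, fun v r hr hro => ?_, fun v => ?_⟩
  · rintro r (hr | hr)
    · rcases h2 r hr with h | h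
      · exact Or.inl h
      · exact Or.inr (Or.inr h)
    · rcases hd.writes_sub r hr with ⟨i, rfl⟩ | h | h
      · right; right; omega
      · exact Or.inr (Or.inl h)
      · right; right; omega
  · rw [run, hd.preserves _ _ (by omega) hro, h3 v r hr]
  · rw [run, hd.value]
    simp only [h4 v _ (Fin.is_lt _)]

/-- Register layout: `b` is the loop counter, `b + 1` the recursion index, `o` the current value, `b
+ 2` the next value, and scratch space starts at `b + 3`. The counter is a copy of the first input
because the loop destroys it. -/
theorem computable_prec {n : ℕ} {f : List.Vector ℕ n → ℕ} {g : List.Vector ℕ (n + 2) → ℕ}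
    (hf : Computable f) (hg : Computable g) :
    Computable fun v : List.Vector ℕ (n + 1) =>
      v.head.rec (f v.tail) fun y IH => g (y ::ᵥ IH ::ᵥ v.tail) := by
  intro ins o b hi ho hio
  have hi' : ∀ i : Fin n, ins i.succ < b := fun i => hi _
  have hio' : ∀ i : Fin n, ins i.succ ≠ o := fun i => hio _
  obtain ⟨c, hc⟩ := hf (fun i => ins i.succ) o (b + 3) (fun i => (hi' i).trans (by omega))
    (by omega) hio'
  let args : Fin (n + 2) → ℕ := Fin.cons (b + 1) (Fin.cons o fun i => ins i.succ)
  have hargs : ∀ i, args i = b + 1 ∨ args i = o ∨ ∃ j, ins j = args i := by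
    refine Fin.cases (Or.inl rfl) (Fin.cases (Or.inr (Or.inl rfl)) fun i => ?_)
    exact Or.inr (Or.inr ⟨_, rfl⟩)
  have hlt : ∀ i, args i < b + 2 := fun i => by
    rcases hargs i with h | h | ⟨j, h⟩
    · omega
    · omega
    · have := hi j; omega
  obtain ⟨d, hd⟩ := hg args (b + 2) (b + 3) (fun i => (hlt i).trans (by omega)) (by omega)
    (fun i => (hlt i).ne)
  let body := seq d (seq (copy (b + 2) o (b + 3)) (add (b + 1) 1))
  have hbody : ∀ r ∈ writes body, (∃ i, ins i = r) ∨ r = o ∨ b + 1 ≤ r := by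
    rintro r (hr | hr | hr)
    · rcases hd.writes_sub r hr with ⟨i, rfl⟩ | h | h
      · rcases hargs i with h | h | h
        · right; right; omega
        · exact Or.inr (Or.inl h)
        · exact Or.inl h
      · right; right; omega
      · right; right; omega
    · rcases writes_copy _ _ _ hr with rfl | rfl | rfl
      · right; right; omega
      · exact Or.inr (Or.inl rfl)
      · right; right; omega
    · right; right; exact (Set.mem_singleton_iff.1 hr).ge
  have hb : b ∉ writes body := fun h => by
    rcases hbody b h with ⟨i, h⟩ | h | h
    · exact (hi i).ne h
    · omega
    · omega
  have hrun : ∀ v, run body v =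
      update (update (update (run d v) o (run d v (b + 2))) (b + 3) 0) (b + 1) (v (b + 1) + 1) := by
    intro v
    simp only [body, run]
    rw [run_copy (by omega) (by omega) (by omega), update_of_ne (a := b + 1) (by omega),
      update_of_ne (a := b + 1) (by omega), hd.preserves v (b + 1) (by omega) (by omega)]
  -- Loop invariant: with `m` rounds left and index `j`, register `o` holds the recursion at `j`;
  -- the loop then leaves the recursion at `j + m`.
  have hloop : ∀ (t : List.Vector ℕ n) (m j : ℕ) (w : ℕ → ℕ), w b = m → w (b + 1) = j →
      w o = j.rec (f t) (fun y IH => g (y ::ᵥ IH ::ᵥ t)) →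
      (List.Vector.ofFn fun i : Fin n => w (ins i.succ)) = t →
      (run (loop b body) w) o = (j + m).rec (f t) (fun y IH => g (y ::ᵥ IH ::ᵥ t)) ∧
        ∀ r, r < b → r ≠ o → run (loop b body) w r = w r := by
    intro t m
    induction m with
    | zero =>
      intro j w h1 h2 h3 h4
      rw [run_loop_zero h1]
      exact ⟨h3, fun _ _ _ => rfl⟩
    | succ m ih =>
      intro j w h1 h2 h3 h4
      rw [run_loop_succ hb h1]
      have hpres : ∀ r, r < b → r ≠ o → run body (update w b m) r = w r := by
        intro r hr hro
        rw [hrun, update_of_ne (by omega), update_of_ne (by omega), update_of_ne hro,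
          hd.preserves _ _ (by omega) (by omega), update_of_ne (by omega)]
      have hvals : (List.Vector.ofFn fun i => update w b m (args i)) = j ::ᵥ w o ::ᵥ t := by
        have h : (fun i => update w b m (args i)) =
            Fin.cons j (Fin.cons (w o) fun i => w (ins i.succ)) := by
          funext i
          refine Fin.cases ?_ (Fin.cases ?_ fun i => ?_) i
          · simp [args, h2]
          · simp [args, ho.ne]
          · simp [args, (hi i.succ).ne]
        rw [h, ← h4]
        rfl
      obtain ⟨h5, h6⟩ := ih (j + 1) (run body (update w b m))
        (by rw [run_eq_of_notMem hb, update_self])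
        (by rw [hrun, update_self, update_of_ne (by omega), h2])
        (by
          rw [hrun, update_of_ne (by omega), update_of_ne (by omega), update_self, hd.value, hvals,
            h3])
        (by simp only [hpres _ (hi' _) (hio' _), h4])
      refine ⟨by rw [h5, Nat.add_right_comm, Nat.add_assoc], fun r hr hro => ?_⟩
      rw [h6 r hr hro, hpres r hr hro]
  have h0 : ins 0 ≠ b := (hi 0).ne
  have h03 : ins 0 ≠ b + 3 := ((hi 0).trans (by omega)).ne
  let prog := seq (clear (b + 1)) (seq c (seq (copy (ins 0) b (b + 3)) (loop b body)))
  have hprog : ∀ v, run prog v o =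
      (v (ins 0)).rec (f (List.Vector.ofFn fun i : Fin n => v (ins i.succ)))
        (fun y IH => g (y ::ᵥ IH ::ᵥ (List.Vector.ofFn fun i : Fin n => v (ins i.succ)))) ∧
      ∀ r, r < b → r ≠ o → run prog v r = v r := by
    intro v
    simp only [prog, run.eq_3, run_clear, run_copy h0 h03 (show b ≠ b + 3 by omega)]
    set u := run c (update v (b + 1) 0) with hu
    have hpres : ∀ r, r < b → r ≠ o → u r = v r := fun r hr hro => by
      rw [hu, hc.preserves _ _ (by omega) hro, update_of_ne (by omega)]
    have hw : ∀ r, r < b → update (update u b (u (ins 0))) (b + 3) 0 r = u r := fun r hr => by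
      rw [update_of_ne (by omega), update_of_ne (by omega)]
    obtain ⟨h5, h6⟩ := hloop (List.Vector.ofFn fun i : Fin n => v (ins i.succ)) (v (ins 0)) 0
      (update (update u b (u (ins 0))) (b + 3) 0)
      (by rw [update_of_ne (by omega), update_self, hpres _ (hi 0) (hio 0)])
      (by
        rw [update_of_ne (by omega), update_of_ne (by omega), hu,
          hc.preserves _ _ (by omega) (by omega), update_self])
      (by
        rw [hw o ho, hu, hc.value]
        simp only [update_of_ne ((hi' _).trans (Nat.lt_succ_self b)).ne]
        rfl)
      (by simp only [hw _ (hi' _), hpres _ (hi' _) (hio' _)])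
    refine ⟨by rw [h5, Nat.zero_add], fun r hr hro => ?_⟩
    rw [h6 r hr hro, hw r hr, hpres r hr hro]
  refine ⟨prog, ⟨wf_clear _, hc.wf, wf_copy h0 h03, hb, ?_⟩, ?_, fun v => (hprog v).2, fun v => ?_⟩
  · exact ⟨hd.wf, wf_copy (by omega) (by omega), trivial⟩
  · rintro r (hr | hr | hr | hr | hr)
    · simp only [clear, writes, Set.mem_insert_iff, Set.mem_empty_iff_false, or_false] at hr
      right; right; omega
    · rcases hc.writes_sub r hr with ⟨i, h⟩ | h | h
      · exact Or.inl ⟨_, h⟩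
      · exact Or.inr (Or.inl h)
      · right; right; omega
    · rcases writes_copy _ _ _ hr with rfl | rfl | rfl
      · exact Or.inl ⟨0, rfl⟩
      · right; right; omega
      · right; right; omega
    · right; right; omega
    · rcases hbody r hr with h | h | h
      · exact Or.inl h
      · exact Or.inr (Or.inl h)
      · right; right; omega
  · rw [(hprog v).1]
    simp [List.Vector.ofFn]

theorem computable_of_primrec' {n : ℕ} {f : List.Vector ℕ n → ℕ} (hf : Nat.Primrec' f) :
    Computable f := by
  induction hf with
  | zero => exact computable_zero
  | succ => exact computable_succ
  | get i => exact computable_get i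
  | comp g _ _ hf hg => exact computable_comp hf hg
  | prec _ _ hf hg => exact computable_prec hf hg

end LoopProg

/-! ### Counter machines -/

/-- Instructions of a counter machine: `inc r k t` adds `k` to register `r` and jumps to `t`;
`dec r t u` decrements `r` and jumps to `t` if `r` is positive, and jumps to `u` otherwise. -/
inductive CounterInstr : Type
  | inc (r k t : ℕ) : CounterInstr
  | dec (r t u : ℕ) : CounterInstr

namespace CounterInstr

open Function

/-- The effect of an instruction on the registers, together with the next position. -/
def exec : CounterInstr → (ℕ → ℕ) → ℕ × (ℕ → ℕ)
  | inc r k t, v => (t, update v r (v r + k))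
  | dec r t u, v => if v r = 0 then (u, v) else (t, update v r (v r - 1))

/-- All jump targets satisfy `p`. -/
def Targets (p : ℕ → Prop) : CounterInstr → Prop
  | inc _ _ t => p t
  | dec _ t u => p t ∧ p u

theorem Targets.mono {p q : ℕ → Prop} (h : ∀ t, p t → q t) :
    ∀ {I : CounterInstr}, I.Targets p → I.Targets q
  | inc _ _ _, hI => h _ hI
  | dec _ _ _, hI => ⟨h _ hI.1, h _ hI.2⟩

end CounterInstr

/-- A step of a counter machine; it halts at positions without an instruction. -/
def counterStep (C : List CounterInstr) (x : ℕ × (ℕ → ℕ)) : Option (ℕ × (ℕ → ℕ)) :=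
  C[x.1]?.map fun I => I.exec x.2

/-- No instruction jumps to itself, and all jumps stay within the code or go just past its end. -/
def WellTargeted (C : List CounterInstr) : Prop :=
  ∀ (s : ℕ) (I : CounterInstr), C[s]? = some I → I.Targets fun t => t ≠ s ∧ t ≤ C.length

/-- The code `l` occurs in `C` at position `a`. -/
def CodeAt (C : List CounterInstr) (a : ℕ) (l : List CounterInstr) : Prop :=
  ∀ i I, l[i]? = some I → C[a + i]? = some I

theorem CodeAt.left {C l m : List CounterInstr} {a : ℕ} (h : CodeAt C a (l ++ m)) :
    CodeAt C a l := fun i I hi => h i I (by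
  rwa [List.getElem?_append_left (List.getElem?_eq_some_iff.1 hi).1])

theorem CodeAt.right {C l m : List CounterInstr} {a : ℕ} (h : CodeAt C a (l ++ m)) :
    CodeAt C (a + l.length) m := fun i I hi => by
  rw [Nat.add_assoc]
  exact h _ I (by rwa [List.getElem?_append_right (by omega), Nat.add_sub_cancel_left])

theorem CodeAt.head {C l : List CounterInstr} {I : CounterInstr} {a : ℕ} (h : CodeAt C a (I :: l)) :
    C[a]? = some I := h 0 I rfl

theorem CodeAt.tail {C l : List CounterInstr} {I : CounterInstr} {a : ℕ} (h : CodeAt C a (I :: l)) :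
    CodeAt C (a + 1) l := CodeAt.right (l := [I]) h

/-! ### Compiling loop programs to counter machines -/

namespace LoopProg

open Function StateTransition

/-- The number of instructions of the compiled program. -/
def size : LoopProg → ℕ
  | skip => 0
  | add _ _ => 1
  | seq c d => size c + size d
  | loop _ c => size c + 2

/-- Code for a loop program to be placed at position `a`. -/
def compile : LoopProg → ℕ → List CounterInstr
  | skip, _ => []
  | add r k, a => [.inc r k (a + 1)]
  | seq c d, a => compile c a ++ compile d (a + size c)
  -- Adding `0` serves as an unconditional jump back to the test; it also keeps an empty body from
  -- producing a self-jump.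
  | loop r c, a => .dec r (a + 1) (a + size c + 2) :: (compile c (a + 1) ++ [.inc r 0 a])

theorem length_compile : ∀ (c : LoopProg) (a : ℕ), (compile c a).length = size c
  | skip, _ => rfl
  | add _ _, _ => rfl
  | seq c d, a => by simp [compile, size, length_compile]
  | loop r c, a => by simp [compile, size, length_compile]

theorem targets_compile : ∀ (c : LoopProg) (a i : ℕ) (I : CounterInstr),
    (compile c a)[i]? = some I → I.Targets fun t => t ≠ a + i ∧ t ≤ a + size c
  | skip, _, _, _, h => by simp [compile] at h
  | add r k, a, i, I, h => by
    rcases i with _ | i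
    · obtain rfl : CounterInstr.inc r k (a + 1) = I := by simpa [compile] using h
      exact ⟨by omega, le_rfl⟩
    · simp [compile] at h
  | seq c d, a, i, I, h => by
    rw [compile, List.getElem?_append, length_compile] at h
    split_ifs at h with hi
    · exact (targets_compile c a i I h).mono fun t ht => ⟨ht.1, by rw [size]; omega⟩
    · exact (targets_compile d _ _ I h).mono fun t ht => ⟨by omega, by rw [size]; omega⟩
  | loop r c, a, i, I, h => by
    rcases i with _ | i
    · obtain rfl : CounterInstr.dec r (a + 1) (a + size c + 2) = I := by simpa [compile] using h
      exact ⟨⟨by omega, by rw [size]; omega⟩, ⟨by omega, by rw [size]; omega⟩⟩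
    · rw [compile, List.getElem?_cons_succ, List.getElem?_append, length_compile] at h
      split_ifs at h with hi
      · exact (targets_compile c _ i I h).mono fun t ht => ⟨by omega, by rw [size]; omega⟩
      · rcases Nat.eq_zero_or_pos (i - size c) with h0 | h0
        · obtain rfl : CounterInstr.inc r 0 a = I := by simpa [h0] using h
          exact ⟨by omega, by omega⟩
        · rw [List.getElem?_eq_none (by simp only [List.length_singleton]; omega)] at h
          cases h

theorem reaches_single {C : List CounterInstr} {s : ℕ} {I : CounterInstr} (h : C[s]? = some I)
    (v : ℕ → ℕ) : Reaches (counterStep C) (s, v) (I.exec v) :=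
  Relation.ReflTransGen.single (by simp [counterStep, h])

theorem reaches_run {C : List CounterInstr} : ∀ {c : LoopProg} {a : ℕ},
    CodeAt C a (compile c a) → c.WF → ∀ v, Reaches (counterStep C) (a, v) (a + size c, run c v)
  | skip, _, _, _, _ => .refl
  | add _ _, _, h, _, v => reaches_single h.head v
  | seq c d, a, h, hc, v => by
    have hd := h.right
    rw [length_compile] at hd
    rw [size, ← Nat.add_assoc]
    exact (reaches_run h.left hc.1 v).trans (reaches_run hd hc.2 _)
  | loop r c, a, h, hc, v => by
    have hend := h.tail.right.head
    rw [length_compile] at hend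
    -- Termination of the loop is induction on its counter, which the body does not change by
    -- well-formedness.
    induction hm : v r generalizing v with
    | zero =>
      rw [run_loop_zero hm]
      simpa [CounterInstr.exec, hm, size, Nat.add_assoc] using reaches_single h.head v
    | succ m ih =>
      rw [run_loop_succ hc.1 hm]
      have h1 : Reaches (counterStep C) (a, v) (a + 1, update v r m) := by
        simpa [CounterInstr.exec, hm] using reaches_single h.head v
      have h2 := reaches_run h.tail.left hc.2 (update v r m)
      have h3 : Reaches (counterStep C) (a + 1 + size c, run c (update v r m))
          (a, run c (update v r m)) := by
        simpa [CounterInstr.exec] using reaches_single hend (run c (update v r m))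
      refine ((h1.trans h2).trans h3).trans (ih _ ?_)
      rw [run_eq_of_notMem hc.1, update_self]

/-- From every position inside the code of a loop program the end of the code is reached. -/
theorem reaches_end {C : List CounterInstr} : ∀ {c : LoopProg} {a s : ℕ},
    CodeAt C a (compile c a) → c.WF → a ≤ s → s ≤ a + size c → ∀ v,
      ∃ w, Reaches (counterStep C) (s, v) (a + size c, w)
  | skip, a, s, _, _, h1, h2, v => by
    obtain rfl : s = a := le_antisymm h2 h1
    exact ⟨v, .refl⟩
  | add r k, a, s, h, hc, h1, h2, v => by
    rcases h1.eq_or_lt with rfl | h1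
    · exact ⟨_, reaches_run h hc v⟩
    · obtain rfl : s = a + 1 := le_antisymm h2 h1
      exact ⟨v, .refl⟩
  | seq c d, a, s, h, hc, h1, h2, v => by
    have hd := h.right
    rw [length_compile] at hd
    rw [size, ← Nat.add_assoc] at h2 ⊢
    rcases le_total s (a + size c) with hs | hs
    · obtain ⟨w, hw⟩ := reaches_end h.left hc.1 h1 hs v
      exact ⟨_, hw.trans (reaches_run hd hc.2 w)⟩
    · exact reaches_end hd hc.2 hs h2 v
  | loop r c, a, s, h, hc, h1, h2, v => by
    rcases h1.eq_or_lt with rfl | h1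
    · exact ⟨_, reaches_run h hc v⟩
    rw [size] at h2
    rcases h2.eq_or_lt with rfl | h2
    · exact ⟨v, .refl⟩
    have hend := h.tail.right.head
    rw [length_compile] at hend
    -- A start inside the body finishes that pass, jumps back to the test, and then runs the whole
    -- loop from its beginning.
    obtain ⟨w, hw⟩ := reaches_end h.tail.left hc.2 h1 (by omega) v
    exact ⟨_, (hw.trans (reaches_single hend w)).trans (reaches_run h hc _)⟩

/-- Repeat the program `c` until register `o` is nonzero afterwards. -/
def repeatUntil (c : LoopProg) (o : ℕ) : List CounterInstr :=
  compile c 0 ++ [.dec o (size c + 1) 0]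

theorem length_repeatUntil (c : LoopProg) (o : ℕ) : (repeatUntil c o).length = size c + 1 := by
  simp [repeatUntil, length_compile]

theorem codeAt_repeatUntil (c : LoopProg) (o : ℕ) :
    CodeAt (repeatUntil c o) 0 (compile c 0) :=
  CodeAt.left (m := [.dec o (size c + 1) 0]) fun i I h => by rwa [Nat.zero_add]

theorem getElem?_repeatUntil (c : LoopProg) (o : ℕ) :
    (repeatUntil c o)[size c]? = some (.dec o (size c + 1) 0) := by
  simp [repeatUntil, length_compile]

/-- For empty `c` the final test would sit at position `0` and jump to itself, hence the size
condition. -/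
theorem wellTargeted_repeatUntil {c : LoopProg} (hc : 0 < size c) (o : ℕ) :
    WellTargeted (repeatUntil c o) := by
  intro s I h
  rw [length_repeatUntil]
  rcases lt_or_ge s (size c) with hs | hs
  · rw [repeatUntil, List.getElem?_append_left (by rwa [length_compile])] at h
    exact (targets_compile c 0 s I h).mono fun t ht => by omega
  · have hlt := (List.getElem?_eq_some_iff.1 h).1
    rw [length_repeatUntil] at hlt
    obtain rfl : s = size c := by omega
    rw [getElem?_repeatUntil] at h
    obtain rfl := Option.some_inj.1 h
    exact ⟨⟨by omega, by omega⟩, ⟨by omega, by omega⟩⟩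

section repeatUntil

variable {c : LoopProg} {o : ℕ}

theorem haltsFrom_repeatUntil_zero (hc : c.WF) (v : ℕ → ℕ) :
    HaltsFrom (counterStep (repeatUntil c o)) (0, v) ↔
      HaltsFrom (counterStep (repeatUntil c o)) (size c, run c v) := by
  simpa using haltsFrom_iff_of_reaches (reaches_run (codeAt_repeatUntil c o) hc v)

theorem haltsFrom_repeatUntil_past_end (v : ℕ → ℕ) :
    HaltsFrom (counterStep (repeatUntil c o)) (size c + 1, v) := by
  apply haltsFrom_of_eq_none
  rw [counterStep, List.getElem?_eq_none (length_repeatUntil c o).le, Option.map_none]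

theorem haltsFrom_repeatUntil_end (v : ℕ → ℕ) :
    HaltsFrom (counterStep (repeatUntil c o)) (size c, v) ↔
      v o ≠ 0 ∨ HaltsFrom (counterStep (repeatUntil c o)) (0, v) := by
  by_cases h : v o = 0
  · have : counterStep (repeatUntil c o) (size c, v) = some (0, v) := by
      simp [counterStep, getElem?_repeatUntil, CounterInstr.exec, h]
    simp [haltsFrom_iff_of_eq_some this, h]
  · have : counterStep (repeatUntil c o) (size c, v) = some (size c + 1, update v o (v o - 1)) := by
      simp [counterStep, getElem?_repeatUntil, CounterInstr.exec, h]
    simp [haltsFrom_iff_of_eq_some this, h, haltsFrom_repeatUntil_past_end]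

/-- The repetition halts when some iterate of the program makes `o` nonzero. -/
theorem haltsFrom_repeatUntil_of_iterate (hc : c.WF) {j : ℕ} {v : ℕ → ℕ}
    (h : (run c)^[j + 1] v o ≠ 0) : HaltsFrom (counterStep (repeatUntil c o)) (0, v) := by
  induction j generalizing v with
  | zero => exact (haltsFrom_repeatUntil_zero hc v).2 ((haltsFrom_repeatUntil_end _).2 (Or.inl h))
  | succ j ih =>
    exact (haltsFrom_repeatUntil_zero hc v).2 ((haltsFrom_repeatUntil_end _).2
      (Or.inr (ih (by rwa [Function.iterate_succ_apply] at h))))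

/-- A start in mid-code reaches the final test with uncontrolled registers `w`; this is why the
hypothesis must cover every `v`. -/
theorem haltsFrom_repeatUntil_of_forall (hc : c.WF) (h : ∀ v, ∃ j, (run c)^[j + 1] v o ≠ 0) {s : ℕ}
    (hs : s ≤ size c + 1) (v : ℕ → ℕ) : HaltsFrom (counterStep (repeatUntil c o)) (s, v) := by
  rcases hs.eq_or_lt with rfl | hs
  · exact haltsFrom_repeatUntil_past_end v
  · obtain ⟨w, hw⟩ := reaches_end (codeAt_repeatUntil c o) hc (Nat.zero_le s)
      (by omega) v
    rw [Nat.zero_add] at hw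
    obtain ⟨j, hj⟩ := h w
    exact (haltsFrom_iff_of_reaches hw).2 ((haltsFrom_repeatUntil_end w).2
      (Or.inr (haltsFrom_repeatUntil_of_iterate hc hj)))

theorem not_haltsFrom_repeatUntil (hc : c.WF) {v : ℕ → ℕ} (h : ∀ j, (run c)^[j + 1] v o = 0) :
    ¬ HaltsFrom (counterStep (repeatUntil c o)) (0, v) := by
  refine not_haltsFrom_of_invariant
    (fun x => ∃ w, x = (0, w) ∧ ∀ j, (run c)^[j + 1] w o = 0) ?_ ⟨v, rfl, h⟩
  rintro _ ⟨w, rfl, hw⟩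
  refine ⟨(0, run c w), ⟨_, rfl, fun j => by rw [← Function.iterate_succ_apply]; exact hw _⟩, ?_⟩
  have h1 := reaches_run (codeAt_repeatUntil c o) hc w
  rw [Nat.zero_add] at h1
  refine Relation.TransGen.tail' h1 ?_
  have h2 : run c w o = 0 := hw 0
  simp [counterStep, getElem?_repeatUntil, CounterInstr.exec, h2]

end repeatUntil

end LoopProg

/-! ### Fractran programs simulating counter machines -/

namespace FractranSim

open Function

noncomputable section

/-- The prime whose presence marks position `i` of the code. -/
def posPrime (i : ℕ) : ℕ+ := ⟨Nat.nth Nat.Prime (2 * i), (Nat.prime_nth_prime _).pos⟩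

/-- The prime whose exponent is the value of register `r`. -/
def regPrime (r : ℕ) : ℕ+ := ⟨Nat.nth Nat.Prime (2 * r + 1), (Nat.prime_nth_prime _).pos⟩

theorem prime_posPrime (i : ℕ) : (posPrime i : ℕ).Prime := Nat.prime_nth_prime _

theorem prime_regPrime (r : ℕ) : (regPrime r : ℕ).Prime := Nat.prime_nth_prime _

theorem posPrime_inj {i j : ℕ} : (posPrime i : ℕ) = posPrime j ↔ i = j := by
  refine ⟨fun h => ?_, fun h => h ▸ rfl⟩
  -- Marker primes have even index and register primes odd index, so all of them are distinct.
  have := Nat.nth_injective Nat.infinite_setOfPred_prime h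
  omega

theorem regPrime_inj {i j : ℕ} : (regPrime i : ℕ) = regPrime j ↔ i = j := by
  refine ⟨fun h => ?_, fun h => h ▸ rfl⟩
  have := Nat.nth_injective Nat.infinite_setOfPred_prime h
  omega

theorem posPrime_ne_regPrime (i r : ℕ) : (posPrime i : ℕ) ≠ regPrime r := fun h => by
  have := Nat.nth_injective Nat.infinite_setOfPred_prime h
  omega

theorem regPrime_ne_posPrime (r i : ℕ) : (regPrime r : ℕ) ≠ posPrime i :=
  (posPrime_ne_regPrime i r).symm

theorem factorization_posPrime (i p : ℕ) :
    (posPrime i : ℕ).factorization p = if p = posPrime i then 1 else 0 := by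
  rw [(prime_posPrime i).factorization, Finsupp.single_apply]
  exact if_congr eq_comm rfl rfl

theorem factorization_regPrime (r p : ℕ) :
    (regPrime r : ℕ).factorization p = if p = regPrime r then 1 else 0 := by
  rw [(prime_regPrime r).factorization, Finsupp.single_apply]
  exact if_congr eq_comm rfl rfl

theorem factorization_posPrime_mul_pow (i r k p : ℕ) :
    ((posPrime i : ℕ) * (regPrime r : ℕ) ^ k).factorization p =
      (if p = posPrime i then 1 else 0) + k * (if p = regPrime r then 1 else 0) := by
  rw [Nat.factorization_mul (prime_posPrime i).ne_zero
    (pow_ne_zero _ (prime_regPrime r).ne_zero), Nat.factorization_pow, Finsupp.add_apply,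
    factorization_posPrime, Finsupp.smul_apply, factorization_regPrime, smul_eq_mul]

/-- The fractions for an instruction at position `s`. -/
def instrFractions (s : ℕ) : CounterInstr → List (ℕ+ × ℕ+)
  | .inc r k t => [(posPrime t * regPrime r ^ k, posPrime s)]
  -- The order implements the zero test: the second fraction is reached only when the register prime
  -- is absent.
  | .dec r t u => [(posPrime t, posPrime s * regPrime r), (posPrime u, posPrime s)]

/-- The fractions for code beginning at position `a`. -/
def codeFractions : ℕ → List CounterInstr → List (ℕ+ × ℕ+)
  | _, [] => []
  | a, I :: C => instrFractions a I ++ codeFractions (a + 1) C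

/-- Fractions removing pairs of position markers. -/
def cleanupFractions (L : ℕ) : List (ℕ+ × ℕ+) :=
  -- The case `i = j` removes repeated markers, and `L` itself is included as the halting position
  -- just past the code.
  (List.range (L + 1)).flatMap fun i => (List.range (L + 1)).map fun j =>
    (1, posPrime i * posPrime j)

/-- The Fractran program simulating a counter machine. -/
def program (C : List CounterInstr) : FractranProgram :=
  cleanupFractions C.length ++ codeFractions 0 C

end

theorem mem_cleanupFractions {L : ℕ} {x : ℕ+ × ℕ+} :
    x ∈ cleanupFractions L ↔ ∃ i ≤ L, ∃ j ≤ L, x = (1, posPrime i * posPrime j) := by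
  simp [cleanupFractions, eq_comm]

theorem mem_codeFractions {a : ℕ} {C : List CounterInstr} {x : ℕ+ × ℕ+} :
    x ∈ codeFractions a C ↔ ∃ i I, C[i]? = some I ∧ x ∈ instrFractions (a + i) I := by
  induction C generalizing a with
  | nil => simp [codeFractions]
  | cons J C ih =>
    rw [codeFractions, List.mem_append, ih]
    constructor
    · rintro (h | ⟨i, I, h1, h2⟩)
      · exact ⟨0, J, rfl, h⟩
      · exact ⟨i + 1, I, h1, by rwa [Nat.add_right_comm, Nat.add_assoc] at h2⟩
    · rintro ⟨_ | i, I, h1, h2⟩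
      · obtain rfl : J = I := by simpa using h1
        exact Or.inl h2
      · exact Or.inr ⟨i, I, h1, by rwa [Nat.add_right_comm, Nat.add_assoc]⟩

/-- If only the block of position `s` can contain a hit, the search through the code reduces to that
block. -/
theorem find?_codeFractions {p : ℕ+ × ℕ+ → Bool} {a s : ℕ} {C : List CounterInstr}
    (hp : ∀ i I, C[i]? = some I → a + i ≠ s → ∀ x ∈ instrFractions (a + i) I, p x = false)
    (has : a ≤ s) :
    (codeFractions a C).find? p = C[s - a]?.bind fun I => (instrFractions s I).find? p := by
  induction C generalizing a with
  | nil => simp [codeFractions]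
  | cons J C ih =>
    have hp' : ∀ i I, C[i]? = some I → a + 1 + i ≠ s →
        ∀ x ∈ instrFractions (a + 1 + i) I, p x = false := fun i I hi his => by
      rw [Nat.add_right_comm, Nat.add_assoc] at his ⊢
      exact hp (i + 1) I hi his
    rw [codeFractions, List.find?_append]
    rcases has.eq_or_lt with rfl | has
    · have : (codeFractions (a + 1) C).find? p = none := by
        rw [List.find?_eq_none]
        intro x hx
        obtain ⟨i, I, h1, h2⟩ := mem_codeFractions.1 hx
        simp [hp' i I h1 (by omega) x h2]
      simp [this]
    · have h0 : (instrFractions a J).find? p = none := by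
        rw [List.find?_eq_none]
        intro x hx
        simp [hp 0 J rfl has.ne x hx]
      rw [h0, Option.none_or, ih hp' has]
      obtain ⟨d, rfl⟩ := Nat.exists_eq_add_of_lt has
      rw [show a + d + 1 - (a + 1) = d by omega, show a + d + 1 - a = d + 1 by omega,
        List.getElem?_cons_succ]

/-- The number `n` represents the machine state with position `s` and registers `v`; `L` bounds the
positions. -/
structure Represents (L n s : ℕ) (v : ℕ → ℕ) : Prop where
  ne_zero : n ≠ 0
  pos : ∀ i ≤ L, n.factorization (posPrime i) = if i = s then 1 else 0
  reg : ∀ r, n.factorization (regPrime r) = v r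
  le : s ≤ L

theorem dvd_iff_factorization_ne_zero {p n : ℕ} (hp : p.Prime) (hn : n ≠ 0) :
    p ∣ n ↔ n.factorization p ≠ 0 := by
  rw [hp.dvd_iff_one_le_factorization hn, Nat.one_le_iff_ne_zero]

theorem Represents.pos_dvd_iff {L n s i : ℕ} {v : ℕ → ℕ} (h : Represents L n s v) (hi : i ≤ L) :
    (posPrime i : ℕ) ∣ n ↔ i = s := by
  rw [dvd_iff_factorization_ne_zero (prime_posPrime i) h.ne_zero, h.pos i hi]
  simp

theorem Represents.reg_dvd_iff {L n s r : ℕ} {v : ℕ → ℕ} (h : Represents L n s v) :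
    (regPrime r : ℕ) ∣ n ↔ v r ≠ 0 := by
  rw [dvd_iff_factorization_ne_zero (prime_regPrime r) h.ne_zero, h.reg]

theorem represents_mul_pow {L s : ℕ} (hs : s ≤ L) (r x : ℕ) :
    Represents L (posPrime s * regPrime r ^ x) s (Pi.single r x) := by
  have h0 : (regPrime r : ℕ) ^ x ≠ 0 := pow_ne_zero _ (prime_regPrime r).ne_zero
  refine ⟨mul_ne_zero (prime_posPrime s).ne_zero h0, fun i _ => ?_, fun r' => ?_, hs⟩
  · simp only [factorization_posPrime_mul_pow, posPrime_inj, posPrime_ne_regPrime, if_false,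
      mul_zero, add_zero]
  · simp only [factorization_posPrime_mul_pow, regPrime_inj, regPrime_ne_posPrime, if_false,
      mul_ite, mul_one, mul_zero, zero_add, Pi.single_apply]

/-- A fraction for an instruction applies only in the presence of its position marker. -/
theorem posPrime_dvd_of_applies {n s : ℕ} {I : CounterInstr} (hI : I.Targets fun t => t ≠ s)
    {x : ℕ+ × ℕ+} (hx : x ∈ instrFractions s I) (h : (x.2 : ℕ) ∣ n * x.1) :
    (posPrime s : ℕ) ∣ n := by
  have hp := prime_posPrime s
  -- Absence of self-jumps keeps the marker of `s` out of the numerator; otherwise it could cancel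
  -- and the fraction could apply without the marker in `n`.
  have hpos : ∀ t, t ≠ s → ¬ (posPrime s : ℕ) ∣ posPrime t := fun t ht hd =>
    ht (posPrime_inj.1 ((Nat.prime_dvd_prime_iff_eq hp (prime_posPrime t)).1 hd)).symm
  rcases I with ⟨r, k, t⟩ | ⟨r, t, u⟩
  · obtain rfl : x = (posPrime t * regPrime r ^ k, posPrime s) := by
      simpa [instrFractions] using hx
    rcases hp.dvd_mul.1 h with h | h
    · exact h
    · rw [PNat.mul_coe, PNat.pow_coe] at h
      rcases hp.dvd_mul.1 h with h | h
      · exact absurd h (hpos t hI)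
      · exact absurd ((Nat.prime_dvd_prime_iff_eq hp (prime_regPrime r)).1 (hp.dvd_of_dvd_pow h))
          (posPrime_ne_regPrime _ _)
  · simp only [instrFractions, List.mem_cons, List.not_mem_nil, or_false] at hx
    rcases hx with rfl | rfl
    · rw [PNat.mul_coe] at h
      exact (hp.dvd_mul.1 ((dvd_mul_right _ _).trans h)).resolve_right (hpos t hI.1)
    · exact (hp.dvd_mul.1 h).resolve_right (hpos u hI.2)

theorem Represents.find?_cleanup {L n s : ℕ} {v : ℕ → ℕ} (h : Represents L n s v) :
    ((cleanupFractions L).find? fun x => decide ((x.2 : ℕ) ∣ n * (x.1 : ℕ))) = none := by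
  rw [List.find?_eq_none]
  intro x hx
  obtain ⟨i, hi, j, hj, rfl⟩ := mem_cleanupFractions.1 hx
  simp only [PNat.one_coe, mul_one, PNat.mul_coe, decide_eq_true_eq]
  intro hd
  obtain rfl := (h.pos_dvd_iff hi).1 ((dvd_mul_right _ _).trans hd)
  obtain rfl := (h.pos_dvd_iff hj).1 ((dvd_mul_left _ _).trans hd)
  rw [← sq, (prime_posPrime _).pow_dvd_iff_le_factorization h.ne_zero, h.pos _ hi] at hd
  simp at hd

theorem Represents.find?_program {C : List CounterInstr} (hC : WellTargeted C) {n s : ℕ}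
    {v : ℕ → ℕ} (h : Represents C.length n s v) :
    ((program C).find? fun x => decide ((x.2 : ℕ) ∣ n * (x.1 : ℕ))) =
      C[s]?.bind fun I => (instrFractions s I).find? fun x => decide ((x.2 : ℕ) ∣ n * (x.1 : ℕ)) := by
  rw [program, List.find?_append, h.find?_cleanup, Option.none_or,
    find?_codeFractions (s := s) ?_ (Nat.zero_le s), Nat.sub_zero]
  intro i I hi his x hx
  rw [decide_eq_false_iff_not]
  intro hd
  rw [Nat.zero_add] at his hx
  have hlt := (List.getElem?_eq_some_iff.1 hi).1
  have := posPrime_dvd_of_applies ((hC i I hi).mono fun t ht => ht.1) hx hd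
  exact his ((h.pos_dvd_iff hlt.le).1 this)

theorem factorization_add_of_mul_eq {m d n k : ℕ} (hm : m ≠ 0) (hd : d ≠ 0) (hn : n ≠ 0)
    (hk : k ≠ 0) (h : m * d = n * k) (p : ℕ) :
    m.factorization p + d.factorization p = n.factorization p + k.factorization p := by
  have := congrArg (fun x => Nat.factorization x p) h
  simpa [Nat.factorization_mul, hm, hd, hn, hk] using this

/-- A step of the machine is simulated by a step of the Fractran program. -/
theorem Represents.step {C : List CounterInstr} (hC : WellTargeted C) {n s : ℕ} {v : ℕ → ℕ}
    (h : Represents C.length n s v) {I : CounterInstr} (hI : C[s]? = some I) :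
    ∃ m, fractranStep (program C) n = some m ∧
      Represents C.length m (I.exec v).1 (I.exec v).2 := by
  have hT := hC s I hI
  have hs : (posPrime s : ℕ) ∣ n := (h.pos_dvd_iff h.le).2 rfl
  have hfind := h.find?_program hC
  rw [hI, Option.bind_some] at hfind
  -- The step is tracked through valuations: for the selected fraction, `m * x.2 = n * x.1`
  -- determines every exponent of `m`.
  have main : ∀ x : ℕ+ × ℕ+,
      ((instrFractions s I).find? fun x => decide ((x.2 : ℕ) ∣ n * (x.1 : ℕ))) = some x →
      ((x.2 : ℕ) ∣ n * x.1) → ∃ m, fractranStep (program C) n = some m ∧ m ≠ 0 ∧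
        ∀ p, m.factorization p + (x.2 : ℕ).factorization p =
          n.factorization p + (x.1 : ℕ).factorization p := by
    intro x hx hd
    refine ⟨n * x.1 / x.2, ?_, ?_, ?_⟩
    · rw [fractranStep, hfind, hx, Option.map_some]
    · exact (Nat.div_pos (Nat.le_of_dvd (Nat.mul_pos (Nat.pos_of_ne_zero h.ne_zero) x.1.pos) hd)
        x.2.pos).ne'
    · refine factorization_add_of_mul_eq ?_ x.2.ne_zero h.ne_zero x.1.ne_zero
        (Nat.div_mul_cancel hd)
      exact (Nat.div_pos (Nat.le_of_dvd (Nat.mul_pos (Nat.pos_of_ne_zero h.ne_zero) x.1.pos) hd)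
        x.2.pos).ne'
  have hpr := posPrime_ne_regPrime
  have hrp := regPrime_ne_posPrime
  rcases I with ⟨r, k, t⟩ | ⟨r, t, u⟩
  · have hd : ((posPrime s : ℕ+) : ℕ) ∣ n * (posPrime t * regPrime r ^ k : ℕ+) := hs.mul_right _
    obtain ⟨m, h1, h2, h3⟩ := main (posPrime t * regPrime r ^ k, posPrime s)
      (by simp [instrFractions, hs.mul_right]) hd
    have hk : ∀ p, ((posPrime t * regPrime r ^ k : ℕ+) : ℕ).factorization p =
        (if p = posPrime t then 1 else 0) + k * (if p = regPrime r then 1 else 0) := by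
      intro p
      rw [PNat.mul_coe, PNat.pow_coe, factorization_posPrime_mul_pow]
    refine ⟨m, h1, h2, fun i hi => ?_, fun r' => ?_, hT.2⟩
    · have := h3 (posPrime i)
      simp only [hk, factorization_posPrime, h.pos i hi, posPrime_inj, hpr, if_false] at this
      change _ = if i = t then 1 else 0
      omega
    · have := h3 (regPrime r')
      simp only [hk, factorization_posPrime, h.reg, regPrime_inj, hrp, if_false] at this
      simp only [CounterInstr.exec, update_apply]
      split_ifs at * <;> subst_vars <;> omega
  · have hts : t ≠ s := hT.1.1
    have hus : u ≠ s := hT.2.1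
    by_cases hv : v r = 0
    · have hnd : ¬ ((posPrime s * regPrime r : ℕ+) : ℕ) ∣ n * posPrime t := by
        intro hd
        have : (regPrime r : ℕ) ∣ n * posPrime t :=
          (by rw [PNat.mul_coe]; exact dvd_mul_left _ _ : (regPrime r : ℕ) ∣ _).trans hd
        rcases (prime_regPrime r).dvd_mul.1 this with h4 | h4
        · exact h.reg_dvd_iff.1 h4 hv
        · exact hrp _ _ ((Nat.prime_dvd_prime_iff_eq (prime_regPrime r) (prime_posPrime t)).1 h4)
      obtain ⟨m, h1, h2, h3⟩ := main (posPrime u, posPrime s)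
        (by
          rw [instrFractions, List.find?_cons_of_neg (by simpa only [decide_eq_true_eq] using hnd),
            List.find?_cons_of_pos (by simpa using hs.mul_right _)])
        (hs.mul_right _)
      rw [CounterInstr.exec, if_pos hv]
      refine ⟨m, h1, h2, fun i hi => ?_, fun r' => ?_, hT.2.2⟩
      · have := h3 (posPrime i)
        simp only [factorization_posPrime, h.pos i hi, posPrime_inj] at this
        change _ = if i = u then 1 else 0
        omega
      · have := h3 (regPrime r')
        simpa only [factorization_posPrime, h.reg, hrp, if_false, add_zero] using this
    · have hd : ((posPrime s * regPrime r : ℕ+) : ℕ) ∣ n := by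
        rw [PNat.mul_coe]
        exact Nat.Coprime.mul_dvd_of_dvd_of_dvd
          ((Nat.coprime_primes (prime_posPrime s) (prime_regPrime r)).2 (hpr s r)) hs
          (h.reg_dvd_iff.2 hv)
      obtain ⟨m, h1, h2, h3⟩ := main (posPrime t, posPrime s * regPrime r)
        (by rw [instrFractions, List.find?_cons_of_pos (by simpa only [decide_eq_true_eq] using hd.mul_right _)])
        (hd.mul_right _)
      have hk : ∀ p, ((posPrime s * regPrime r : ℕ+) : ℕ).factorization p =
          (if p = posPrime s then 1 else 0) + if p = regPrime r then 1 else 0 := by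
        intro p
        rw [PNat.mul_coe]
        simpa using factorization_posPrime_mul_pow s r 1 p
      rw [CounterInstr.exec, if_neg hv]
      refine ⟨m, h1, h2, fun i hi => ?_, fun r' => ?_, hT.1.2⟩
      · have := h3 (posPrime i)
        simp only [hk, factorization_posPrime, h.pos i hi, posPrime_inj, hpr, if_false] at this
        change _ = if i = t then 1 else 0
        omega
      · have := h3 (regPrime r')
        simp only [hk, factorization_posPrime, h.reg, regPrime_inj, hrp, if_false] at this
        simp only [update_apply]
        split_ifs at * <;> subst_vars <;> omega

theorem Represents.haltsOn_iff {C : List CounterInstr} (hC : WellTargeted C) {n s : ℕ} {v : ℕ → ℕ}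
    (h : Represents C.length n s v) :
    FractranHaltsOn (program C) n ↔ HaltsFrom (counterStep C) (s, v) := by
  have hr : StateTransition.Respects (counterStep C) (fractranStep (program C))
      (fun x n => Represents C.length n x.1 x.2) := by
    rintro ⟨s, v⟩ n h
    rcases hI : C[s]? with _ | I
    · have : fractranStep (program C) n = none := by
        rw [fractranStep, h.find?_program hC]
        simp [hI]
      simpa [counterStep, hI] using this
    · obtain ⟨m, h1, h2⟩ := h.step hC hI
      simpa [counterStep, hI] using ⟨m, h2, Relation.TransGen.single h1⟩
  rw [fractranHaltsOn_iff, haltsFrom_iff_eval_dom, haltsFrom_iff_eval_dom]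
  exact StateTransition.tr_eval_dom hr (a₁ := (s, v)) h

/-- Strong induction on `n`: a cleanup fraction makes `n` smaller; without one, `n` has exactly one
marker and represents a machine state, or has none and no fraction applies. -/
theorem uniformHalting_program {C : List CounterInstr} (hC : WellTargeted C)
    (h : ∀ s ≤ C.length, ∀ v, HaltsFrom (counterStep C) (s, v)) :
    FractranUniformHalting (program C) := by
  intro n
  induction n using Nat.strong_induction_on with
  | _ n ih =>
  intro hn
  rcases hc : ((cleanupFractions C.length).find? fun x => decide ((x.2 : ℕ) ∣ n * (x.1 : ℕ)))
    with _ | x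
  · rw [List.find?_eq_none] at hc
    have hc' : ∀ i ≤ C.length, ∀ j ≤ C.length, ¬ (posPrime i * posPrime j : ℕ) ∣ n := by
      intro i hi j hj hd
      refine hc _ (mem_cleanupFractions.2 ⟨i, hi, j, hj, rfl⟩) ?_
      simpa using hd
    by_cases hex : ∃ s ≤ C.length, (posPrime s : ℕ) ∣ n
    · obtain ⟨s, hs, hd⟩ := hex
      -- The registers are read off from `n`; all other prime factors are unconstrained by
      -- `Represents` and do not matter.
      have hrep : Represents C.length n s fun r => n.factorization (regPrime r) := by
        refine ⟨hn.ne', fun i hi => ?_, fun _ => rfl, hs⟩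
        have h1 := (dvd_iff_factorization_ne_zero (prime_posPrime s) hn.ne').1 hd
        split_ifs with his
        · subst his
          have h2 := hc' i hi i hi
          rw [← sq, (prime_posPrime _).pow_dvd_iff_le_factorization hn.ne'] at h2
          omega
        · by_contra h2
          rw [← Ne, ← dvd_iff_factorization_ne_zero (prime_posPrime i) hn.ne'] at h2
          exact hc' i hi s hs (Nat.Coprime.mul_dvd_of_dvd_of_dvd
            ((Nat.coprime_primes (prime_posPrime i) (prime_posPrime s)).2
              fun e => his (posPrime_inj.1 e)) h2 hd)
      exact (hrep.haltsOn_iff hC).2 (h s hs _)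
    · refine haltsFrom_of_eq_none (fractranStep_eq_none_iff.2 fun x hx hd => ?_)
      rcases List.mem_append.1 hx with hx | hx
      · exact hc x hx (by simpa using hd)
      · obtain ⟨i, I, hi, hx⟩ := mem_codeFractions.1 hx
        rw [Nat.zero_add] at hx
        exact hex ⟨i, (List.getElem?_eq_some_iff.1 hi).1.le,
          posPrime_dvd_of_applies ((hC i I hi).mono fun t ht => ht.1) hx hd⟩
  · have hd : (x.2 : ℕ) ∣ n * x.1 := by simpa using List.find?_some hc
    obtain ⟨i, _, j, _, rfl⟩ := mem_cleanupFractions.1 (List.mem_of_find?_eq_some hc)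
    have hstep : fractranStep (program C) n = some (n / (posPrime i * posPrime j : ℕ+)) := by
      rw [fractranStep, program, List.find?_append, hc]
      simp
    refine (haltsFrom_iff_of_eq_some hstep).2 (ih _ (Nat.div_lt_self hn ?_) ?_)
    · rw [PNat.mul_coe]
      exact Nat.one_lt_mul_iff.2 ⟨(posPrime i).pos, (posPrime j).pos,
        Or.inl (prime_posPrime i).one_lt⟩
    · exact fractranStep_pos hn hstep

end FractranSim

/-! ### Hardness -/

/-- A `Π⁰₂` set has a definition by a primitive recursive relation monotone in the existentially
quantified variable. -/
theorem IsPi02.exists_primrec {q : ℕ → Prop} (hq : IsPi02 q) :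
    ∃ h : List.Vector ℕ 3 → ℕ, Primrec h ∧
      (∀ a x k l, k ≤ l → h (a ::ᵥ x ::ᵥ k ::ᵥ .nil) ≠ 0 → h (a ::ᵥ x ::ᵥ l ::ᵥ .nil) ≠ 0) ∧
      ∀ a, q a ↔ ∀ x, ∃ k, h (a ::ᵥ x ::ᵥ k ::ᵥ .nil) ≠ 0 := by
  obtain ⟨R, ⟨_, hR⟩, hq⟩ := hq
  -- The inner existential is the domain of an unbounded search, and `evaln` with fuel `k` makes it
  -- primitive recursive and monotone in `k`.
  have hg : Partrec fun m : ℕ =>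
      Nat.rfind fun y => Part.some (decide (R (m.unpair.1, m.unpair.2, y))) := by
    refine Partrec.rfind (p := fun (m y : ℕ) => Part.some (decide (R (m.unpair.1, m.unpair.2, y)))) ?_
    refine Computable.partrec (hR.comp ?_)
    exact Computable.pair (Computable.fst.comp (Computable.unpair.comp .fst))
      (Computable.pair (Computable.snd.comp (Computable.unpair.comp .fst)) .snd)
  obtain ⟨c, hc⟩ := Nat.Partrec.Code.exists_code.1 (Partrec.nat_iff.1 hg)
  have hdom : ∀ a x, (∃ y, R (a, x, y)) ↔
      ∃ k, (Nat.Partrec.Code.evaln k c (Nat.pair a x)).isSome = true := by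
    intro a x
    have h1 : (c.eval (Nat.pair a x)).Dom ↔ ∃ y, R (a, x, y) := by
      rw [hc]
      refine Nat.rfind_dom'.trans ?_
      simp
    rw [← h1, Part.dom_iff_mem]
    simp only [Nat.Partrec.Code.evaln_complete, Option.isSome_iff_exists, Option.mem_def]
    exact exists_comm
  refine ⟨fun v => bif (Nat.Partrec.Code.evaln (v.get 2) c
    (Nat.pair (v.get 0) (v.get 1))).isSome then 1 else 0, ?_, ?_, fun a => ?_⟩
  · have get : ∀ i : Fin 3, Primrec fun v : List.Vector ℕ 3 => v.get i := fun i =>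
      Primrec.vector_get.comp .id (.const i)
    exact Primrec.cond (Primrec.option_isSome.comp (Nat.Partrec.Code.primrec_evaln.comp
      (Primrec.pair (Primrec.pair (get 2) (.const c)) (Primrec₂.natPair.comp (get 0) (get 1)))))
      (.const 1) (.const 0)
  · intro a x k l hkl h
    change (bif (Nat.Partrec.Code.evaln k c (Nat.pair a x)).isSome then 1 else 0) ≠ 0 at h
    change (bif (Nat.Partrec.Code.evaln l c (Nat.pair a x)).isSome then 1 else 0) ≠ 0
    rcases hk : Nat.Partrec.Code.evaln k c (Nat.pair a x) with _ | y
    · simp [hk] at h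
    · have : Nat.Partrec.Code.evaln l c (Nat.pair a x) = some y :=
        Nat.Partrec.Code.evaln_mono hkl hk
      simp [this]
  · rw [hq]
    simp only [hdom]
    refine forall_congr' fun x => exists_congr fun k => ?_
    change _ ↔ (bif (Nat.Partrec.Code.evaln k c (Nat.pair a x)).isSome then 1 else 0) ≠ 0
    cases (Nat.Partrec.Code.evaln k c (Nat.pair a x)).isSome <;> simp

/-! ### The search machine for a `Π⁰₂` condition -/

namespace LoopProg

open Function

/-- One round of a search: store `N` in register `0`, increment register `2` and run `c`. -/
def searchStep (c : LoopProg) (N : ℕ) : LoopProg :=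
  seq (clear 0) (seq (add 0 N) (seq (add 2 1) c))

section searchStep

variable {c : LoopProg} {h : List.Vector ℕ 3 → ℕ}

theorem run_searchStep (hc : Computes c h ![0, 1, 2] 3 4) (N : ℕ) (v : ℕ → ℕ) :
    run (searchStep c N) v 1 = v 1 ∧ run (searchStep c N) v 2 = v 2 + 1 ∧
      run (searchStep c N) v 3 = h (N ::ᵥ v 1 ::ᵥ (v 2 + 1) ::ᵥ .nil) := by
  simp only [searchStep, run.eq_3, run_clear, run.eq_2]
  refine ⟨?_, ?_, ?_⟩
  · rw [hc.preserves _ _ (by omega) (by omega)]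
    simp
  · rw [hc.preserves _ _ (by omega) (by omega)]
    simp
  · rw [hc.value]
    simp [List.Vector.ofFn]

theorem iterate_run_searchStep (hc : Computes c h ![0, 1, 2] 3 4) (N : ℕ) (v : ℕ → ℕ) (j : ℕ) :
    (run (searchStep c N))^[j] v 1 = v 1 ∧ (run (searchStep c N))^[j] v 2 = v 2 + j := by
  induction j with
  | zero => exact ⟨rfl, rfl⟩
  | succ j ih =>
    rw [iterate_succ_apply', (run_searchStep hc N _).1, (run_searchStep hc N _).2.1, ih.1, ih.2]
    exact ⟨rfl, rfl⟩

theorem iterate_run_searchStep_output (hc : Computes c h ![0, 1, 2] 3 4) (N : ℕ) (v : ℕ → ℕ)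
    (j : ℕ) :
    (run (searchStep c N))^[j + 1] v 3 = h (N ::ᵥ v 1 ::ᵥ (v 2 + j + 1) ::ᵥ .nil) := by
  rw [iterate_succ_apply', (run_searchStep hc N _).2.2, (iterate_run_searchStep hc N v j).1,
    (iterate_run_searchStep hc N v j).2]

/-- A failing `x` yields a divergent run from the state with `x` in register `1`. If no `x` fails,
every start halts, since each round preserves register `1` and raises register `2`. -/
theorem uniformHalting_search_iff (hc : Computes c h ![0, 1, 2] 3 4) (N : ℕ)
    (hmono : ∀ x k l, k ≤ l → h (N ::ᵥ x ::ᵥ k ::ᵥ .nil) ≠ 0 → h (N ::ᵥ x ::ᵥ l ::ᵥ .nil) ≠ 0) :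
    FractranUniformHalting (FractranSim.program (repeatUntil (searchStep c N) 3)) ↔
      ∀ x, ∃ k, h (N ::ᵥ x ::ᵥ k ::ᵥ .nil) ≠ 0 := by
  have hwf : (searchStep c N).WF := ⟨wf_clear 0, trivial, trivial, hc.wf⟩
  have hC : WellTargeted (repeatUntil (searchStep c N) 3) :=
    wellTargeted_repeatUntil (by simp only [searchStep, size, clear]; omega) 3
  constructor
  · intro hH x
    by_contra! hx
    have hrep := FractranSim.represents_mul_pow
      (Nat.zero_le (repeatUntil (searchStep c N) 3).length) 1 x
    refine not_haltsFrom_repeatUntil hwf (fun j => ?_)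
      ((hrep.haltsOn_iff hC).1 (hH _ (Nat.pos_of_ne_zero hrep.ne_zero)))
    rw [iterate_run_searchStep_output hc]
    simpa using hx _
  · intro hx
    refine FractranSim.uniformHalting_program hC fun s hs v => ?_
    rw [length_repeatUntil] at hs
    refine haltsFrom_repeatUntil_of_forall hwf (fun v => ?_) hs v
    obtain ⟨k, hk⟩ := hx (v 1)
    -- After `k + 1` rounds the search bound is `v 2 + k + 1 ≥ k`, so monotonicity applies whatever
    -- `v 2` was.
    refine ⟨k, ?_⟩
    rw [iterate_run_searchStep_output hc]
    exact hmono _ _ _ (by omega) hk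

end searchStep

end LoopProg

/-! ### Computability of the reduction -/

theorem Primrec.nat_pow : Primrec₂ ((· ^ ·) : ℕ → ℕ → ℕ) :=
  Primrec₂.unpaired'.1 Nat.Primrec.pow

theorem Primrec.pnat_of_val {α : Type*} [Primcodable α] {f : α → ℕ+}
    (hf : Primrec fun a => (f a : ℕ)) : Primrec f :=
  (Primrec.nat_succPNat.comp (Primrec.pred.comp hf)).of_eq fun a =>
    PNat.succPNat_natPred (f a)

theorem primrec_search_program (c : LoopProg) :
    Primrec fun N => FractranSim.program (LoopProg.repeatUntil (c.searchStep N) 3) := by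
  -- `clear 0` occupies positions `0` and `1`, so `add 0 N` sits at position `2` and jumps to `3`.
  -- Its fraction is the only place where `N` enters; the rest, including the primes, is constant.
  obtain ⟨A, B, hAB⟩ : ∃ A B : FractranProgram, ∀ N,
      FractranSim.program (LoopProg.repeatUntil (c.searchStep N) 3) = A ++
        (FractranSim.posPrime 3 * FractranSim.regPrime 0 ^ N, FractranSim.posPrime 2) :: B := by
    refine ⟨FractranSim.cleanupFractions ((c.searchStep 0).size + 1) ++
        FractranSim.codeFractions 0 ((LoopProg.clear 0).compile 0),
      FractranSim.codeFractions 3 (((LoopProg.add 2 1).seq c).compile 3 ++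
        [.dec 3 ((c.searchStep 0).size + 1) 0]), fun N => ?_⟩
    rw [FractranSim.program, LoopProg.length_repeatUntil, List.append_assoc]
    rfl
  have hx : Primrec fun N =>
      (FractranSim.posPrime 3 * FractranSim.regPrime 0 ^ N, FractranSim.posPrime 2) := by
    refine Primrec.pair (Primrec.pnat_of_val ?_) (Primrec.const _)
    simp only [PNat.mul_coe, PNat.pow_coe]
    exact Primrec.nat_mul.comp (Primrec.const _) (Primrec.nat_pow.comp (Primrec.const _) .id)
  exact (Primrec.list_append.comp (Primrec.const A)
    (Primrec.list_cons.comp hx (Primrec.const B))).of_eq fun N => (hAB N).symm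

theorem isPi02Hard_fractranUniformHalting : IsPi02Hard FractranUniformHalting := by
  intro q hq
  obtain ⟨h, hh, hmono, hiff⟩ := hq.exists_primrec
  -- The program `c` depends only on `h`, so it stays fixed while the instance `a` varies.
  obtain ⟨c, hc⟩ := LoopProg.computable_of_primrec' (Nat.Primrec'.of_prim hh) ![0, 1, 2] 3 4
    (by decide) (by decide) (by decide)
  exact ⟨_, (primrec_search_program c).to_comp, fun a => by
    rw [hiff, LoopProg.uniformHalting_search_iff hc a (hmono a)]⟩

theorem mainTheorem6 :
    (∀ P : FractranProgram,
      IsCollatzFunction (fractranTotalStep P) ∧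
        (FractranUniformHalting P ↔ AllReachOne (fractranTotalStep P))) ∧
    (∃ t : FractranProgram → CollatzCode, Computable t ∧
      ∀ P : FractranProgram,
        (t P).length = fractranDenLcm P ∧ CollatzRepresents (t P) (fractranTotalStep P) ∧
          (FractranUniformHalting P ↔ GeneralisedCollatz (t P))) ∧
    IsPi02Hard FractranUniformHalting ∧
    IsPi02Complete GeneralisedCollatz := by
  refine ⟨fun P => ⟨isCollatzFunction_fractranTotalStep P,
    fractranUniformHalting_iff_allReachOne P⟩,
    ⟨fractranToCollatz, primrec_fractranToCollatz.to_comp, fun P =>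
      ⟨length_fractranToCollatz P, fractranToCollatz_represents P,
        fractranUniformHalting_iff_generalisedCollatz P⟩⟩,
    isPi02Hard_fractranUniformHalting, isPi02_generalisedCollatz, fun q hq => ?_⟩
  exact (isPi02Hard_fractranUniformHalting q hq).trans
    ⟨_, primrec_fractranToCollatz.to_comp, fractranUniformHalting_iff_generalisedCollatz⟩
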